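/- Let $\alpha,u_0>0$, let $u_\pm\in\mathbb C$ with $|u_\pm|=u_0$, and let $u(x,t)$ be a function (for instance a solution of $iu_t+u_{xx}+4i\alpha u_x+\frac{i}{\alpha}(|u|^2u)_x=0$) that for every $t$ is continuous in $x\in\mathbb R$ with $u(\cdot,t)-u_-\in L^1(-\infty,0)$ and $u(\cdot,t)-u_+\in L^1(0,\infty)$. A star denotes (entrywise) complex conjugation. Put $$\sigma_1=\begin{pmatrix}0&1\\1&0\end{pmatrix},\quad \sigma_3=\begin{pmatrix}1&0\\0&-1\end{pmatrix},\quad \sigma_*=\begin{pmatrix}0&1\\-1&0\end{pmatrix},\quad Q=\begin{pmatrix}0&u\\u^*&0\end{pmatrix},\quad Q_\pm=\begin{pmatrix}0&u_\pm\\u_\pm^*&0\end{pmatrix},$$ $$k(z)=\tfrac1{2\alpha}\Big(z-\tfrac{u_0^2}{z}\Big),\quad \lambda(z)=\tfrac12\Big(z+\tfrac{u_0^2}{z}\Big),\quad \theta=-k\lambda\Big[x+\Big(2\alpha k^2-4\alpha-\tfrac{u_0^2}{\alpha}\Big)t\Big],\quad Y_\pm=I+\tfrac1z\sigma_3Q_\pm,\quad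 \gamma=\det Y_\pm=1+\tfrac{u_0^2}{z^2},$$ $\Delta X_\pm=ik(Q-Q_\pm)$, $e^{a\hat\sigma_3}A=e^{a\sigma_3}Ae^{-a\sigma_3}$. Let $D^\pm=\{\mp\,\mathrm{Re}\,z\,\mathrm{Im}\,z>0\}$ and $\Sigma=(\mathbb R\cup i\mathbb R)\setminus\{0\}$; the points $z=0$ and $z=\pm iu_0$ are always excluded. The Jost solutions $\varphi_\pm=(\varphi_{\pm,1},\varphi_{\pm,2})$ are the solutions with $\varphi_\pm\to Y_\pm$ as $x\to\pm\infty$ of $$\varphi_-(x)=Y_-+\int_{-\infty}^xY_-e^{-ik\lambda(x-y)\hat\sigma_3}[Y_-^{-1}\Delta X_-\varphi_-](y)\,dy,\qquad \varphi_+(x)=Y_+-\int_x^{\infty}Y_+e^{-ik\lambda(x-y)\hat\sigma_3}[Y_+^{-1}\Delta X_+\varphi_+](y)\,dy,$$ understood column by column, with absolutely convergent integrals. For every $t$ the columns $\varphi_{+,1},\varphi_{-,2}$ exist and are unique for $z\in D^+\cup\Sigma$, and so do $\varphi_{-,1},\varphi_{+,2}$ for $z\in D^-\cup\Sigma$. With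 $\phi_\pm=\varphi_\pm e^{i\theta\sigma_3}$, for each $z\in\Sigma$ there is exactly one matrix $S=(s_{ij})$ (the scattering matrix of $u(\cdot,t)$) with $\phi_+=\phi_-S$ for all $x$; moreover $s_{11}=\det(\varphi_{+,1},\varphi_{-,2})/\gamma$ and $s_{22}=\det(\varphi_{-,1},\varphi_{+,2})/\gamma$, independently of $x$, which defines $s_{11}$ on $D^+\cup\Sigma$ and $s_{22}$ on $D^-\cup\Sigma$. Put $\rho=s_{21}/s_{11}$ and $\tilde\rho=s_{12}/s_{22}$. Then the following hold for all $x,t$ and all $z\ne 0,\pm iu_0$ for which the quantities involved are defined (the matrix identities being read column by column for $\varphi_\pm$ and entry by entry for $S$): 1. $\varphi_\pm(x,t,z)=-\sigma_*\varphi_\pm^*(x,t,z^*)\sigma_*$, $\;S(z)=-\sigma_*S^*(z^*)\sigma_*$, $\;\rho(z)=-\tilde\rho^*(z^*)$; 2. $\varphi_\pm(x,t,z)=\sigma_1\varphi_\pm^*(x,t,-z^*)\sigma_1$, $\;S(z)=\sigma_1S^*(-z^*)\sigma_1$, $\;\rho(z)=\tilde\rho^*(-z^*)$; 3. $\varphi_\pm(x,t,z)=\frac1z\varphi_\pm\big(x,t,-\frac{u_0^2}{z}\big)\sigma_3Q_\pm$,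 $\;S(z)=(\sigma_3Q_-)^{-1}S\big(-\frac{u_0^2}{z}\big)\sigma_3Q_+$, $\;\rho(z)=-\frac{u_-^*}{u_-}\tilde\rho\big(-\frac{u_0^2}{z}\big)$. Consequently $s_{11}$ and $s_{22}$ are even functions of $z$, and $s_{12}$ and $s_{21}$ are odd. -/

import Mathlib

open scoped ComplexConjugate
open MeasureTheory Filter Topology Set Matrix

namespace MNLS

noncomputable section

/-- The two ends `x → -∞` and `x → +∞` of the line, i.e. the subscripts `-` and `+`. -/
inductive Side
  | minus
  | plus

/-- The half-line between `x` and the given end. -/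
def Side.halfLine : Side → ℝ → Set ℝ
  | .minus, x => Iic x
  | .plus, x => Ioi x

/-- The sign in front of the Volterra integral: `+ ∫_{-∞}^x` for `-`, and `- ∫_x^∞` for `+`. -/
def Side.sign : Side → ℂ
  | .minus => 1
  | .plus => -1

/-- The filter `x → -∞` or `x → +∞`. -/
def Side.toEnd : Side → Filter ℝ
  | .minus => atBot
  | .plus => atTop

def sigma1 : Matrix (Fin 2) (Fin 2) ℂ := !![0, 1; 1, 0]

def sigma3 : Matrix (Fin 2) (Fin 2) ℂ := !![1, 0; 0, -1]

/-- The matrix `σ_*`. -/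
def sigmaStar : Matrix (Fin 2) (Fin 2) ℂ := !![0, 1; -1, 0]

/-- Entrywise complex conjugation `A ↦ A^*` (no transposition). -/
def cconj (A : Matrix (Fin 2) (Fin 2) ℂ) : Matrix (Fin 2) (Fin 2) ℂ := A.map (starRingEnd ℂ)

/-- The matrix `e^{c σ₃}`. -/
def expSigma3 (c : ℂ) : Matrix (Fin 2) (Fin 2) ℂ :=
  !![Complex.exp c, 0; 0, Complex.exp (-c)]

/-- The matrix `Q` of the potential value `w`; `Q_±` is `Qmat u_±`. -/
def Qmat (w : ℂ) : Matrix (Fin 2) (Fin 2) ℂ := !![0, w; conj w, 0]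

/-- `k(z) = (z - u₀² / z) / (2α)`. -/
def kz (α u₀ : ℝ) (z : ℂ) : ℂ := (z - (u₀ : ℂ) ^ 2 / z) / (2 * (α : ℂ))

/-- `λ(z) = (z + u₀² / z) / 2`. -/
def lamz (u₀ : ℝ) (z : ℂ) : ℂ := (z + (u₀ : ℂ) ^ 2 / z) / 2

/-- `θ(x, t, z) = -k λ [x + (2 α k² - 4 α - u₀² / α) t]`. -/
def theta (α u₀ : ℝ) (x t : ℝ) (z : ℂ) : ℂ :=
  -(kz α u₀ z * lamz u₀ z) *
    ((x : ℂ) + (2 * (α : ℂ) * kz α u₀ z ^ 2 - 4 * (α : ℂ) - (u₀ : ℂ) ^ 2 / (α : ℂ)) * (t : ℂ))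

/-- `γ(z) = 1 + u₀² / z² = det Y_±`. -/
def gam (u₀ : ℝ) (z : ℂ) : ℂ := 1 + (u₀ : ℂ) ^ 2 / z ^ 2

/-- The eigenvector matrix `Y_± = I + z⁻¹ σ₃ Q_±`, where `w = u_±`. -/
def Ymat (w z : ℂ) : Matrix (Fin 2) (Fin 2) ℂ := 1 + z⁻¹ • (sigma3 * Qmat w)

/-- `ΔX_± = i k (Q - Q_±)` at a point where the potential has the value `v`, with `w = u_±`. -/
def DeltaX (α u₀ : ℝ) (z w v : ℂ) : Matrix (Fin 2) (Fin 2) ℂ :=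
  (Complex.I * kz α u₀ z) • (Qmat v - Qmat w)

/-- The `j`-th column of the Volterra integrand
`Y_± e^{-ikλ(x-y) σ₃} [Y_±⁻¹ ΔX_±(y) φ(y)] e^{ikλ(x-y) σ₃}`, where `f` is the `j`-th column of `φ`,
`w = u_±`, and `v` is the potential at a fixed time. -/
def volterraIntegrand (α u₀ : ℝ) (w : ℂ) (v : ℝ → ℂ) (z : ℂ) (j : Fin 2)
    (f : ℝ → Fin 2 → ℂ) (x y : ℝ) : Fin 2 → ℂ :=
  Complex.exp (Complex.I * kz α u₀ z * lamz u₀ z * ((x : ℂ) - (y : ℂ)) * sigma3 j j) •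
    ((Ymat w z * expSigma3 (-(Complex.I * kz α u₀ z * lamz u₀ z * ((x : ℂ) - (y : ℂ)))) *
      (Ymat w z)⁻¹ * DeltaX α u₀ z w (v y)) *ᵥ f y)

/-- `f` is the `j`-th column of the Jost solution `φ_±` at the spectral parameter `z`, for the
potential `v` (at a fixed time) and the limit value `w = u_±`: the Volterra integral converges
absolutely, `f` solves the Volterra integral equation, and `f` tends to the `j`-th column of `Y_±`
at the corresponding end of the line. -/
def IsJostColumn (α u₀ : ℝ) (w : ℂ) (s : Side) (v : ℝ → ℂ) (z : ℂ) (j : Fin 2)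
    (f : ℝ → Fin 2 → ℂ) : Prop :=
  (∀ x, IntegrableOn (volterraIntegrand α u₀ w v z j f x) (s.halfLine x)) ∧
  (∀ x, f x = (fun i => Ymat w z i j) +
    s.sign • ∫ y in s.halfLine x, volterraIntegrand α u₀ w v z j f x y) ∧
  Tendsto f s.toEnd (𝓝 (fun i => Ymat w z i j))

open Classical in
/-- The `j`-th column of `φ_±(·, t, z)`, where `w .minus = u_-` and `w .plus = u_+`: the unique function singled out by `IsJostColumn`.
(The value is `0` at those `z` for which there is no such function.) -/
def jostColumn (α u₀ : ℝ) (w : Side → ℂ) (s : Side) (u : ℝ → ℝ → ℂ) (t : ℝ) (z : ℂ) (j : Fin 2) :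
    ℝ → Fin 2 → ℂ :=
  if h : ∃! f, IsJostColumn α u₀ (w s) s (fun x => u x t) z j f then h.choose else 0

/-- The Jost solution `φ_±(x, t, z)` (normalised so that `φ_± → Y_±` as `x → ±∞`). -/
def jost (α u₀ : ℝ) (w : Side → ℂ) (s : Side) (u : ℝ → ℝ → ℂ) (x t : ℝ) (z : ℂ) :
    Matrix (Fin 2) (Fin 2) ℂ :=
  Matrix.of fun i j => jostColumn α u₀ w s u t z j x i

/-- The Jost solution `φ_± e^{iθσ₃}` of the original (not normalised) Lax pair. -/
def laxJost (α u₀ : ℝ) (w : Side → ℂ) (s : Side) (u : ℝ → ℝ → ℂ) (x t : ℝ) (z : ℂ) :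
    Matrix (Fin 2) (Fin 2) ℂ :=
  jost α u₀ w s u x t z * expSigma3 (Complex.I * theta α u₀ x t z)

/-- The set `D⁺ ∪ Σ` (without the origin being removed). -/
def closedDPlus : Set ℂ := {z | z.re * z.im ≤ 0}

/-- The set `D⁻ ∪ Σ` (without the origin being removed). -/
def closedDMinus : Set ℂ := {z | 0 ≤ z.re * z.im}

/-- The set `Σ = ℝ ∪ iℝ` (without the origin being removed). -/
def contour : Set ℂ := {z | z.re * z.im = 0}

/-- The region of the `z`-plane on which the `j`-th column of `φ_±` is defined: `D⁺ ∪ Σ` for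
`φ_{+,1}` and `φ_{-,2}`, and `D⁻ ∪ Σ` for `φ_{-,1}` and `φ_{+,2}`. -/
def columnDomain : Side → Fin 2 → Set ℂ
  | .plus, 0 => closedDPlus
  | .plus, 1 => closedDMinus
  | .minus, 0 => closedDMinus
  | .minus, 1 => closedDPlus

/-- The Wronskian `Wr(a, b) = det (a, b)` of column `i` of `A` and column `j` of `B`. -/
def wr (A : Matrix (Fin 2) (Fin 2) ℂ) (i : Fin 2) (B : Matrix (Fin 2) (Fin 2) ℂ) (j : Fin 2) : ℂ :=
  A 0 i * B 1 j - A 1 i * B 0 j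

/-- The scattering matrix of the potential `u(·, t)`, through the Wronskians of the Jost solutions
(taken at `x = 0`; they do not depend on `x`). -/
def scatteringMatrix (α u₀ : ℝ) (w : Side → ℂ) (u : ℝ → ℝ → ℂ) (t : ℝ) (z : ℂ) :
    Matrix (Fin 2) (Fin 2) ℂ :=
  let P := laxJost α u₀ w .plus u 0 t z
  let M := laxJost α u₀ w .minus u 0 t z
  (gam u₀ z)⁻¹ • !![wr P 0 M 1, wr P 1 M 1; wr M 0 P 0, wr M 0 P 1]

/-- The reflection coefficient `ρ = s₂₁ / s₁₁`. -/
def rho (α u₀ : ℝ) (w : Side → ℂ) (u : ℝ → ℝ → ℂ) (t : ℝ) (z : ℂ) : ℂ :=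
  scatteringMatrix α u₀ w u t z 1 0 / scatteringMatrix α u₀ w u t z 0 0

/-- The reflection coefficient `ρ̃ = s₁₂ / s₂₂`. -/
def rhoTilde (α u₀ : ℝ) (w : Side → ℂ) (u : ℝ → ℝ → ℂ) (t : ℝ) (z : ℂ) : ℂ :=
  scatteringMatrix α u₀ w u t z 0 1 / scatteringMatrix α u₀ w u t z 1 1

end

end MNLS

open MNLS

/-! Conjugating by `Ymat` turns the kernel of the `j`-th column equation into `P_j + e^{μ(x-y)}
P_{1-j}`, with complementary spectral projections and `μ = 2ikλ(σ₃)_jj`. Since `Im(kλ)` is a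
positive multiple of `Re z · Im z`, this kernel is bounded over the half-line of integration exactly
for the closed regions in `columnDomain`. As `Q - Q_±` is integrable there, a weighted contraction
gives one and only one column (`existsUnique_isTailSolution`, `existsUnique_isJostColumn`).

Differentiating the integral equation and multiplying by `e^{iθσ₃}` gives solutions of `ψ' = Xψ`,
where `X = laxX` is trace-free and the same for both ends and both columns. Wronskians are therefore
constant in `x` (`wr_laxJost_eq`), `det φ_-` on the contour equals its limit `γ ≠ 0`
(`wr_laxJost_self`), and Cramer's rule identifies `S` with the Wronskian matrix.

Each symmetry is a real-linear isomorphism `T` of `ℂ²` that intertwines the Volterra integrands at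
two spectral parameters and matches the corresponding columns of `Y_±`. It carries solutions to
solutions, so uniqueness identifies the columns (`jostColumn_comp`). For the two conjugations `T` is
a signed conjugate swap; for `z ↦ -u₀²/z` it is a scalar, because `k` is fixed, `λ` changes sign and
the two projections trade places. The identities for `S` follow from bilinearity of the Wronskian,
and parity comes from composing the two conjugations. -/

namespace MNLS

/-! ### Tail integrals and the exponential weight. -/

section TailIntegral

theorem intervalIntegrable_of_integrableOn_Ioi {E : Type*} [NormedAddCommGroup E] {h : ℝ → E}
    (hh : ∀ x, IntegrableOn h (Ioi x)) (a b : ℝ) : IntervalIntegrable h volume a b :=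
  ⟨(hh a).mono_set Ioc_subset_Ioi_self, (hh b).mono_set Ioc_subset_Ioi_self⟩

variable {E : Type*} [NormedAddCommGroup E] [NormedSpace ℝ E]

theorem tailIntegral_eq {h : ℝ → E} (hh : ∀ x, IntegrableOn h (Ioi x)) (x : ℝ) :
    ∫ y in Ioi x, h y = (∫ y in Ioi 0, h y) - ∫ y in (0 : ℝ)..x, h y := by
  rw [← intervalIntegral.integral_Ioi_sub_Ioi' (hh 0) (hh x)]
  abel

theorem continuous_tailIntegral {h : ℝ → E} (hh : ∀ x, IntegrableOn h (Ioi x)) :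
    Continuous fun x => ∫ y in Ioi x, h y := by
  rw [funext (tailIntegral_eq hh)]
  exact continuous_const.sub
    (intervalIntegral.continuous_primitive (intervalIntegrable_of_integrableOn_Ioi hh) 0)

theorem hasDerivAt_tailIntegral [CompleteSpace E] {h : ℝ → E} (hh : ∀ x, IntegrableOn h (Ioi x))
    (hc : Continuous h) (x : ℝ) : HasDerivAt (fun x => ∫ y in Ioi x, h y) (-h x) x := by
  rw [funext (tailIntegral_eq hh)]
  simpa using (intervalIntegral.integral_hasDerivAt_right (hc.intervalIntegrable 0 x)
    hc.aestronglyMeasurable.stronglyMeasurableAtFilter hc.continuousAt).const_sub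
      (∫ y in Ioi 0, h y)

theorem tendsto_tailIntegral {h : ℝ → E} (hh : ∀ x, IntegrableOn h (Ioi x)) :
    Tendsto (fun x => ∫ y in Ioi x, h y) atTop (𝓝 0) := by
  rw [funext (tailIntegral_eq hh)]
  simpa using (intervalIntegral_tendsto_integral_Ioi 0 (hh 0) tendsto_id).const_sub
    (∫ y in Ioi 0, h y)

/-- The weight `exp (L ∫_x^∞ q)`, which turns the Volterra operator into a contraction. -/
noncomputable def tailWeight (L : ℝ) (q : ℝ → ℝ) (x : ℝ) : ℝ := Real.exp (L * ∫ y in Ioi x, q y)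

theorem tailWeight_pos (L : ℝ) (q : ℝ → ℝ) (x : ℝ) : 0 < tailWeight L q x := Real.exp_pos _

theorem one_le_tailWeight {L : ℝ} (hL : 0 ≤ L) {q : ℝ → ℝ} (hq0 : ∀ x, 0 ≤ q x) (x : ℝ) :
    1 ≤ tailWeight L q x :=
  Real.one_le_exp (mul_nonneg hL (integral_nonneg hq0))

theorem hasDerivAt_tailWeight (L : ℝ) {q : ℝ → ℝ} (hq : Continuous q)
    (hi : ∀ x, IntegrableOn q (Ioi x)) (x : ℝ) :
    HasDerivAt (tailWeight L q) (-(L * (q x * tailWeight L q x))) x := by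
  convert! ((hasDerivAt_tailIntegral hi hq x).const_mul L).exp using 1
  simp only [tailWeight]
  ring

theorem continuous_tailWeight (L : ℝ) {q : ℝ → ℝ} (hi : ∀ x, IntegrableOn q (Ioi x)) :
    Continuous (tailWeight L q) :=
  Real.continuous_exp.comp (continuous_const.mul (continuous_tailIntegral hi))

theorem tendsto_tailWeight (L : ℝ) {q : ℝ → ℝ} (hi : ∀ x, IntegrableOn q (Ioi x)) :
    Tendsto (tailWeight L q) atTop (𝓝 1) := by
  have h := (Real.continuous_exp.tendsto _).comp ((tendsto_tailIntegral hi).const_mul L)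
  rwa [mul_zero, Real.exp_zero] at h

/-- The integrand is the exact derivative of `-W / L`, and `W → 1` at infinity. The gain `1 / L` is
what makes the Volterra operator contract. -/
theorem integral_mul_tailWeight {L : ℝ} (hL : 0 < L) {q : ℝ → ℝ} (hq : Continuous q)
    (hq0 : ∀ x, 0 ≤ q x) (hi : ∀ x, IntegrableOn q (Ioi x)) (x : ℝ) :
    IntegrableOn (fun y => q y * tailWeight L q y) (Ioi x) ∧
    ∫ y in Ioi x, q y * tailWeight L q y = (tailWeight L q x - 1) / L := by
  have hneg : ∀ y ∈ Ioi x, -(L * (q y * tailWeight L q y)) ≤ 0 := fun y _ =>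
    neg_nonpos.2 (mul_nonneg hL.le (mul_nonneg (hq0 y) (tailWeight_pos _ _ _).le))
  have h1 := integrableOn_Ioi_deriv_of_nonpos' (a := x)
    (fun y _ => hasDerivAt_tailWeight L hq hi y) hneg (tendsto_tailWeight L hi)
  have h2 := integral_Ioi_of_hasDerivAt_of_nonpos' (a := x)
    (fun y _ => hasDerivAt_tailWeight L hq hi y) hneg (tendsto_tailWeight L hi)
  constructor
  · refine IntegrableOn.congr_fun (h1.const_mul (-L⁻¹)) (fun y _ => ?_) measurableSet_Ioi
    field_simp
  · rw [integral_neg, integral_const_mul] at h2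
    rw [eq_div_iff hL.ne']
    linarith

end TailIntegral

/-! ### Abstract Volterra equations with a one-parameter group as kernel. -/

section Volterra

variable {E : Type*} [NormedAddCommGroup E] [NormedSpace ℝ E]

/-- `B` is a one-parameter group with generator `G`, bounded by `C` for negative times. -/
structure IsBoundedGroup (B : ℝ → E →L[ℝ] E) (G : E →L[ℝ] E) (C : ℝ) : Prop where
  map_zero : B 0 = 1
  map_add : ∀ s t, B (s + t) = B s ∘L B t
  hasDerivAt : ∀ s, HasDerivAt B (G ∘L B s) s
  norm_le : ∀ s ≤ 0, ‖B s‖ ≤ C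
  pos : 0 < C

/-- `f` solves `f x = c + ∫_x^∞ B (x - y) (V y) (f y) dy` and tends to `c` at infinity. -/
def IsTailSolution (B V : ℝ → E →L[ℝ] E) (c : E) (f : ℝ → E) : Prop :=
  (∀ x, IntegrableOn (fun y => B (x - y) (V y (f y))) (Ioi x)) ∧
  (∀ x, f x = c + ∫ y in Ioi x, B (x - y) (V y (f y))) ∧
  Tendsto f atTop (𝓝 c)

namespace IsBoundedGroup

variable {B V : ℝ → E →L[ℝ] E} {G : E →L[ℝ] E} {C : ℝ} {c : E} {f g : ℝ → E}

theorem continuous (hB : IsBoundedGroup B G C) : Continuous B :=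
  continuous_iff_continuousAt.2 fun s => (hB.hasDerivAt s).continuousAt

theorem apply_sub (hB : IsBoundedGroup B G C) (x y : ℝ) (v : E) :
    B (x - y) v = B x (B (-y) v) := by
  rw [sub_eq_add_neg, hB.map_add]
  rfl

/-- Since `B (x - y) = B x ∘ B (-y)`, applying `B (-x)` removes `x` from the integrand. The Volterra
integral then becomes `B x` of an ordinary tail integral, which can be differentiated by the product
rule. -/
theorem integrableOn_neg (hB : IsBoundedGroup B G C) {h : ℝ → E}
    (hh : ∀ x, IntegrableOn (fun y => B (x - y) (h y)) (Ioi x)) (x : ℝ) :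
    IntegrableOn (fun y => B (-y) (h y)) (Ioi x) := by
  refine ((B (-x)).integrable_comp (hh x)).congr (Eventually.of_forall fun y => ?_)
  simp only
  rw [← ContinuousLinearMap.comp_apply, ← hB.map_add]
  congr 2
  ring

theorem norm_integrand_le (hB : IsBoundedGroup B G C) {K x y M : ℝ} (hxy : x ≤ y)
    (hf : ‖f y‖ ≤ M * K) : ‖B (x - y) (V y (f y))‖ ≤ C * M * (‖V y‖ * K) := by
  calc ‖B (x - y) (V y (f y))‖ ≤ C * (‖V y‖ * (M * K)) :=
        (B _).le_of_opNorm_le_of_le (hB.norm_le _ (sub_nonpos.2 hxy))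
          ((V y).le_of_opNorm_le_of_le le_rfl hf)
    _ = _ := by ring

variable [CompleteSpace E]

theorem integral_eq (hB : IsBoundedGroup B G C) {h : ℝ → E}
    (hh : ∀ x, IntegrableOn (fun y => B (x - y) (h y)) (Ioi x)) (x : ℝ) :
    ∫ y in Ioi x, B (x - y) (h y) = B x (∫ y in Ioi x, B (-y) (h y)) := by
  rw [← ContinuousLinearMap.integral_comp_comm _ (hB.integrableOn_neg hh x)]
  simp_rw [hB.apply_sub x]

theorem continuous_integral (hB : IsBoundedGroup B G C) {h : ℝ → E}
    (hh : ∀ x, IntegrableOn (fun y => B (x - y) (h y)) (Ioi x)) :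
    Continuous fun x => ∫ y in Ioi x, B (x - y) (h y) := by
  simp_rw [hB.integral_eq hh]
  exact hB.continuous.clm_apply (continuous_tailIntegral (hB.integrableOn_neg hh))

theorem hasDerivAt_integral (hB : IsBoundedGroup B G C) {h : ℝ → E} (hc : Continuous h)
    (hh : ∀ x, IntegrableOn (fun y => B (x - y) (h y)) (Ioi x)) (x : ℝ) :
    HasDerivAt (fun x => ∫ y in Ioi x, B (x - y) (h y))
      (G (∫ y in Ioi x, B (x - y) (h y)) - h x) x := by
  simp_rw [hB.integral_eq hh]
  have hc' : Continuous fun y => B (-y) (h y) :=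
    (hB.continuous.comp continuous_neg).clm_apply hc
  convert! (hB.hasDerivAt x).clm_apply (hasDerivAt_tailIntegral (hB.integrableOn_neg hh) hc' x)
    using 1
  rw [map_neg, ← hB.apply_sub, sub_self, hB.map_zero]
  simp [sub_eq_add_neg]

theorem continuous_of_isTailSolution (hB : IsBoundedGroup B G C) (hf : IsTailSolution B V c f) :
    Continuous f := by
  rw [funext hf.2.1]
  exact continuous_const.add (hB.continuous_integral hf.1)

theorem hasDerivAt_of_isTailSolution (hB : IsBoundedGroup B G C) (hV : Continuous V)
    (hf : IsTailSolution B V c f) (x : ℝ) : HasDerivAt f (G (f x - c) - V x (f x)) x := by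
  have hc := hV.clm_apply (hB.continuous_of_isTailSolution hf)
  have h := (hB.hasDerivAt_integral hc hf.1 x).const_add c
  have e : f x - c = ∫ y in Ioi x, B (x - y) (V y (f y)) := by
    rw [sub_eq_iff_eq_add']; exact hf.2.1 x
  rw [e]
  exact h.congr_of_eventuallyEq (Eventually.of_forall hf.2.1)

end IsBoundedGroup

end Volterra

/-! ### Existence and uniqueness by weighted contraction. -/

namespace IsBoundedGroup

variable {E : Type*} [NormedAddCommGroup E] [NormedSpace ℝ E]
  {B V : ℝ → E →L[ℝ] E} {G : E →L[ℝ] E} {C : ℝ} {c : E} {f g : ℝ → E}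

/-- The kernel contributes a factor `C` and the weight with exponent `2 * C` a factor `1 / (2 * C)`,
so the weighted norm is at least halved. -/
theorem norm_integral_le (hB : IsBoundedGroup B G C) (hV : Continuous V)
    (hi : ∀ x, IntegrableOn (fun y => ‖V y‖) (Ioi x)) {M x : ℝ}
    (hf : ∀ y, x ≤ y → ‖f y‖ ≤ M * tailWeight (2 * C) (fun y => ‖V y‖) y) :
    ‖∫ y in Ioi x, B (x - y) (V y (f y))‖ ≤
      M / 2 * (tailWeight (2 * C) (fun y => ‖V y‖) x - 1) := by
  have hC := hB.pos
  obtain ⟨h1, h2⟩ := integral_mul_tailWeight (L := 2 * C) (by positivity) hV.norm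
    (fun y => norm_nonneg (V y)) hi x
  refine (norm_integral_le_of_norm_le (h1.const_mul (C * M)) ((ae_restrict_iff'
    measurableSet_Ioi).2 (Eventually.of_forall fun y hy =>
      hB.norm_integrand_le (le_of_lt hy) (hf y (le_of_lt hy))))).trans_eq ?_
  rw [integral_const_mul, h2]
  field_simp

theorem integrableOn_of_continuous (hB : IsBoundedGroup B G C) (hV : Continuous V)
    (hi : ∀ x, IntegrableOn (fun y => ‖V y‖) (Ioi x)) (hfc : Continuous f) {M : ℝ}
    (hf : ∀ y, ‖f y‖ ≤ M * tailWeight (2 * C) (fun y => ‖V y‖) y) (x : ℝ) :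
    IntegrableOn (fun y => B (x - y) (V y (f y))) (Ioi x) := by
  have hC := hB.pos
  obtain ⟨h1, -⟩ := integral_mul_tailWeight (L := 2 * C) (by positivity) hV.norm
    (fun y => norm_nonneg (V y)) hi x
  refine Integrable.mono' (h1.const_mul (C * M)) ?_ ((ae_restrict_iff'
    measurableSet_Ioi).2 (Eventually.of_forall fun y hy =>
      hB.norm_integrand_le (le_of_lt hy) (hf y)))
  exact ((hB.continuous.comp (continuous_const.sub continuous_id)).clm_apply
    (hV.clm_apply hfc)).aestronglyMeasurable

variable [CompleteSpace E]

theorem exists_bound_of_isTailSolution (hB : IsBoundedGroup B G C)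
    (hf : IsTailSolution B V c f) (x : ℝ) : ∃ M, ∀ y, x ≤ y → ‖f y‖ ≤ M := by
  obtain ⟨a, ha⟩ := eventually_atTop.1
    (hf.2.2.norm.eventually_le_const (lt_add_one ‖c‖))
  obtain ⟨M, hM⟩ := (isCompact_Icc (a := x) (b := a)).exists_bound_of_continuousOn
    (hB.continuous_of_isTailSolution hf).continuousOn
  refine ⟨max M (‖c‖ + 1), fun y hy => ?_⟩
  rcases le_total y a with h | h
  · exact (hM y ⟨hy, h⟩).trans (le_max_left _ _)
  · exact (ha y h).trans (le_max_right _ _)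

/-- A solution is known a priori to be bounded only on half-lines `[x, ∞)`, so the halving estimate
is iterated there instead of appealing to the fixed point theorem on the whole line. -/
theorem isTailSolution_unique (hB : IsBoundedGroup B G C) (hV : Continuous V)
    (hi : ∀ x, IntegrableOn (fun y => ‖V y‖) (Ioi x))
    (hf : IsTailSolution B V c f) (hg : IsTailSolution B V c g) : f = g := by
  funext x
  set W := tailWeight (2 * C) (fun y => ‖V y‖) with hW
  have hW1 : ∀ y, 1 ≤ W y := one_le_tailWeight (by linarith [hB.pos]) fun y => norm_nonneg (V y)
  obtain ⟨M₁, hM₁⟩ := hB.exists_bound_of_isTailSolution hf x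
  obtain ⟨M₂, hM₂⟩ := hB.exists_bound_of_isTailSolution hg x
  have hM0 : 0 ≤ M₁ + M₂ :=
    add_nonneg ((norm_nonneg _).trans (hM₁ x le_rfl)) ((norm_nonneg _).trans (hM₂ x le_rfl))
  have key : ∀ n : ℕ, ∀ y, x ≤ y → ‖f y - g y‖ ≤ (M₁ + M₂) * (1 / 2) ^ n * W y := by
    intro n
    induction n with
    | zero =>
      intro y hy
      calc ‖f y - g y‖ ≤ M₁ + M₂ := (norm_sub_le _ _).trans (add_le_add (hM₁ y hy) (hM₂ y hy))
        _ ≤ _ := by simpa using le_mul_of_one_le_right hM0 (hW1 y)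
    | succ n ih =>
      intro y hy
      have e : f y - g y = ∫ s in Ioi y, B (y - s) (V s (f s - g s)) := by
        simp only [map_sub]
        rw [integral_sub (hf.1 y) (hg.1 y), hf.2.1 y, hg.2.1 y]
        abel
      rw [e]
      refine (hB.norm_integral_le (f := fun s => f s - g s) hV hi
        fun s hs => ih s (hy.trans hs)).trans ?_
      have h0 : 0 ≤ (M₁ + M₂) * (1 / 2) ^ n := by positivity
      rw [pow_succ]
      nlinarith
  have hlim : Tendsto (fun n : ℕ => (M₁ + M₂) * (1 / 2 : ℝ) ^ n * W x) atTop (𝓝 0) := by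
    simpa using ((tendsto_pow_atTop_nhds_zero_of_lt_one (r := (1 / 2 : ℝ)) (by norm_num)
      (by norm_num)).const_mul (M₁ + M₂)).mul_const (W x)
  have := ge_of_tendsto' hlim fun n => key n x le_rfl
  exact sub_eq_zero.1 (norm_le_zero_iff.1 this)

theorem exists_isTailSolution (hB : IsBoundedGroup B G C) (hV : Continuous V)
    (hi : ∀ x, IntegrableOn (fun y => ‖V y‖) (Ioi x)) (c : E) :
    ∃ f, IsTailSolution B V c f := by
  set W := tailWeight (2 * C) (fun y => ‖V y‖) with hW
  have hW1 : ∀ y, 1 ≤ W y := one_le_tailWeight (by linarith [hB.pos]) fun y => norm_nonneg (V y)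
  have hW0 : ∀ y, 0 < W y := tailWeight_pos _ _
  have hWc : Continuous W := continuous_tailWeight _ hi
  have hgc : ∀ g : BoundedContinuousFunction ℝ E, Continuous fun y => W y • g y :=
    fun g => hWc.smul g.continuous
  have hgb : ∀ (g : BoundedContinuousFunction ℝ E) (y : ℝ), ‖W y • g y‖ ≤ ‖g‖ * W y := by
    intro g y
    rw [norm_smul, Real.norm_of_nonneg (hW0 y).le, mul_comm]
    exact mul_le_mul_of_nonneg_right (g.norm_coe_le_norm y) (hW0 y).le
  have hgi := fun g => hB.integrableOn_of_continuous hV hi (hgc g) (hgb g)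
  have hge := fun (g : BoundedContinuousFunction ℝ E) x =>
    hB.norm_integral_le hV hi (x := x) fun y _ => hgb g y
  -- The unknown is `g = f / W`: the weight may blow up at `-∞`, so `f` itself need not be bounded,
  -- whereas `g` lives in a complete space of bounded functions.
  let T : BoundedContinuousFunction ℝ E → BoundedContinuousFunction ℝ E := fun g =>
    BoundedContinuousFunction.ofNormedAddCommGroup
      (fun x => (W x)⁻¹ • (c + ∫ y in Ioi x, B (x - y) (V y (W y • g y))))
      ((hWc.inv₀ fun x => (hW0 x).ne').smul
        (continuous_const.add (hB.continuous_integral (hgi g))))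
      (‖c‖ + ‖g‖ / 2) (by
        intro x
        rw [norm_smul, norm_inv, Real.norm_of_nonneg (hW0 x).le, inv_mul_le_iff₀ (hW0 x)]
        refine (norm_add_le_of_le le_rfl (hge g x)).trans ?_
        have h1 := hW1 x
        rw [← hW]
        nlinarith [norm_nonneg c, norm_nonneg g])
  have hT : ContractingWith (1 / 2) T := by
    refine ⟨by rw [← NNReal.coe_lt_coe]; norm_num, LipschitzWith.of_dist_le_mul fun g₁ g₂ => ?_⟩
    rw [BoundedContinuousFunction.dist_le (by positivity)]
    intro x
    have e : T g₁ x - T g₂ x = (W x)⁻¹ • ∫ y in Ioi x, B (x - y) (V y (W y • (g₁ - g₂) y)) := by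
      simp only [T, BoundedContinuousFunction.coe_ofNormedAddCommGroup, ← smul_sub,
        BoundedContinuousFunction.coe_sub, Pi.sub_apply]
      simp only [smul_sub, map_sub]
      rw [integral_sub (hgi g₁ x) (hgi g₂ x), smul_sub, smul_add, smul_add]
      abel
    rw [dist_eq_norm, e, norm_smul, norm_inv, Real.norm_of_nonneg (hW0 x).le,
      inv_mul_le_iff₀ (hW0 x), dist_eq_norm]
    refine (hge (g₁ - g₂) x).trans ?_
    rw [← hW]
    push_cast
    nlinarith [norm_nonneg (g₁ - g₂)]
  let g := ContractingWith.fixedPoint T hT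
  have hg : T g = g := hT.fixedPoint_isFixedPt
  have hsol : ∀ x, W x • g x = c + ∫ y in Ioi x, B (x - y) (V y (W y • g y)) := by
    intro x
    conv_lhs => rw [← hg]
    simp only [T, BoundedContinuousFunction.coe_ofNormedAddCommGroup]
    rw [smul_inv_smul₀ (hW0 x).ne']
  refine ⟨fun x => W x • g x, hgi g, hsol, ?_⟩
  rw [tendsto_iff_norm_sub_tendsto_zero]
  -- The `-1` in the integral estimate pays off here: the bound on `f - c` vanishes as `W → 1`.
  have hlim : Tendsto (fun x => ‖g‖ / 2 * (W x - 1)) atTop (𝓝 0) := by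
    simpa using ((tendsto_tailWeight (2 * C) hi).sub_const 1).const_mul (‖g‖ / 2)
  refine squeeze_zero (fun _ => norm_nonneg _) (fun x => ?_) hlim
  rw [hsol x, add_sub_cancel_left]
  exact hge g x

theorem existsUnique_isTailSolution (hB : IsBoundedGroup B G C) (hV : Continuous V)
    (hi : ∀ x, IntegrableOn (fun y => ‖V y‖) (Ioi x)) (c : E) :
    ∃! f, IsTailSolution B V c f := by
  obtain ⟨f, hf⟩ := hB.exists_isTailSolution hV hi c
  exact ⟨f, hf, fun g hg => hB.isTailSolution_unique hV hi hg hf⟩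

end IsBoundedGroup

/-! ### Groups built from two complementary projections. -/

section GroupOfProjections

variable {E : Type*} [NormedAddCommGroup E] [NormedSpace ℝ E] [NormedSpace ℂ E]
  [IsScalarTower ℝ ℂ E]

/-- The bound for `s ≤ 0` is `|e^{μs}| ≤ 1`, which is where the sign of `Re μ` enters. The extra `1`
in the constant only secures positivity. -/
theorem isBoundedGroup_of_projections {P P' : E →L[ℝ] E} (h1 : P ∘L P = P) (h2 : P' ∘L P' = P')
    (h3 : P ∘L P' = 0) (h4 : P' ∘L P = 0) (h5 : P + P' = 1)
    (hP' : ∀ (a : ℂ) v, P' (a • v) = a • P' v) (hP : ∀ (a : ℂ) v, P (a • v) = a • P v)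
    {μ : ℂ} (hμ : 0 ≤ μ.re) :
    IsBoundedGroup (fun s : ℝ => P + Complex.exp (μ * s) • P') (μ • P') (‖P‖ + ‖P'‖ + 1) where
  map_zero := by simpa using h5
  map_add s t := by
    have h1' := fun v => DFunLike.congr_fun h1 v
    have h2' := fun v => DFunLike.congr_fun h2 v
    have h3' := fun v => DFunLike.congr_fun h3 v
    have h4' := fun v => DFunLike.congr_fun h4 v
    simp only [ContinuousLinearMap.comp_apply, _root_.zero_apply] at h1' h2' h3' h4'
    ext v
    simp [hP, hP', h1', h2', h3', h4', mul_add, Complex.exp_add, smul_smul]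
  hasDerivAt s := by
    have hd : HasDerivAt (fun s : ℝ => Complex.exp (μ * s)) (Complex.exp (μ * s) * (μ * 1)) s :=
      (((hasDerivAt_id (s : ℂ)).const_mul μ).cexp).comp_ofReal
    convert! (hd.smul_const P').const_add P using 1
    ext v
    have h2' := DFunLike.congr_fun h2 v
    have h4' := DFunLike.congr_fun h4 v
    simp only [ContinuousLinearMap.comp_apply, _root_.zero_apply] at h2' h4'
    simp [hP', h2', h4', smul_smul, mul_comm]
  norm_le s hs := by
    refine (norm_add_le _ _).trans ?_
    rw [norm_smul, Complex.norm_exp]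
    have : Real.exp (μ * s).re ≤ 1 := by
      rw [Real.exp_le_one_iff]
      simpa using mul_nonpos_of_nonneg_of_nonpos hμ hs
    nlinarith [norm_nonneg P']
  pos := by positivity

end GroupOfProjections

/-- The real-linear continuous map `v ↦ A *ᵥ v`. -/
noncomputable def mulVecCLM (A : Matrix (Fin 2) (Fin 2) ℂ) : (Fin 2 → ℂ) →L[ℝ] (Fin 2 → ℂ) :=
  LinearMap.toContinuousLinearMap (A.mulVecLin.restrictScalars ℝ)

@[simp]
theorem mulVecCLM_apply (A : Matrix (Fin 2) (Fin 2) ℂ) (v : Fin 2 → ℂ) :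
    mulVecCLM A v = A *ᵥ v := rfl

theorem mulVecCLM_mul (A B : Matrix (Fin 2) (Fin 2) ℂ) :
    mulVecCLM (A * B) = mulVecCLM A ∘L mulVecCLM B := by
  ext1 v
  simp only [ContinuousLinearMap.comp_apply, mulVecCLM_apply, Matrix.mulVec_mulVec]

theorem mulVecCLM_one : mulVecCLM 1 = 1 := by
  ext1 v
  simp

theorem mulVecCLM_zero : mulVecCLM 0 = 0 := by
  ext1 v
  simp

theorem mulVecCLM_add (A B : Matrix (Fin 2) (Fin 2) ℂ) :
    mulVecCLM (A + B) = mulVecCLM A + mulVecCLM B := by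
  ext1 v
  simp [Matrix.add_mulVec]

/-! ### The eigenvector matrix `Y_±` and its spectral projections. -/

theorem mul_conj_of_norm {w : ℂ} {u₀ : ℝ} (hw : ‖w‖ = u₀) : w * conj w = (u₀ : ℂ) ^ 2 := by
  rw [Complex.mul_conj', hw]

theorem Ymat_eq (w z : ℂ) : Ymat w z = !![1, w / z; -(conj w / z), 1] := by
  ext i j
  fin_cases i <;> fin_cases j <;> simp [Ymat, sigma3, Qmat, div_eq_inv_mul]

theorem gam_ne_zero {u₀ : ℝ} {z : ℂ} (hz : z ≠ 0) (hz' : z ^ 2 ≠ -(u₀ : ℂ) ^ 2) :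
    gam u₀ z ≠ 0 := by
  intro h
  apply hz'
  unfold gam at h
  field_simp at h
  linear_combination h

theorem det_Ymat {u₀ : ℝ} {w z : ℂ} (hw : ‖w‖ = u₀) : (Ymat w z).det = gam u₀ z := by
  rw [Ymat_eq, Matrix.det_fin_two_of, gam, ← mul_conj_of_norm hw]
  ring

theorem Ymat_inv {u₀ : ℝ} {w z : ℂ} (hw : ‖w‖ = u₀) :
    (Ymat w z)⁻¹ = (gam u₀ z)⁻¹ • !![1, -(w / z); conj w / z, 1] := by
  rw [Matrix.inv_def, det_Ymat hw, Ymat_eq, Matrix.adjugate_fin_two_of, Ring.inverse_eq_inv,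
    neg_neg]

theorem diagonal_single_zero :
    Matrix.diagonal (Pi.single (0 : Fin 2) (1 : ℂ)) = !![1, 0; 0, 0] := by
  ext i k
  fin_cases i <;> fin_cases k <;> simp

theorem diagonal_single_one :
    Matrix.diagonal (Pi.single (1 : Fin 2) (1 : ℂ)) = !![0, 0; 0, 1] := by
  ext i k
  fin_cases i <;> fin_cases k <;> simp

/-- The spectral projection `Y E_{jj} Y⁻¹` onto the `j`-th column of `Y`. -/
noncomputable def spectralProj (w z : ℂ) (j : Fin 2) : Matrix (Fin 2) (Fin 2) ℂ :=
  Ymat w z * Matrix.diagonal (Pi.single j 1) * (Ymat w z)⁻¹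

section Proj

variable {u₀ : ℝ} {w z : ℂ}

theorem isUnit_det_Ymat (hw : ‖w‖ = u₀) (hγ : gam u₀ z ≠ 0) : IsUnit (Ymat w z).det := by
  rw [det_Ymat hw]
  exact hγ.isUnit

theorem spectralProj_mul (hY : IsUnit (Ymat w z).det) (i j : Fin 2) :
    spectralProj w z i * spectralProj w z j = if i = j then spectralProj w z i else 0 := by
  unfold spectralProj
  rw [Matrix.mul_assoc, ← Matrix.mul_assoc _ (Ymat w z * _) _,
    Matrix.nonsing_inv_mul_cancel_left _ _ hY,
    ← Matrix.mul_assoc, Matrix.mul_assoc (Ymat w z), Matrix.diagonal_mul_diagonal]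
  split_ifs with h
  · subst h
    congr 3
    ext k
    by_cases hk : k = i <;> simp [hk]
  · have : (fun k => (Pi.single i 1 : Fin 2 → ℂ) k * (Pi.single j 1 : Fin 2 → ℂ) k) = 0 := by
      ext k
      by_cases hk : k = i
      · subst hk
        simp [h]
      · simp [hk]
    rw [this]
    simp

theorem spectralProj_add (hY : IsUnit (Ymat w z).det) (j : Fin 2) :
    spectralProj w z j + spectralProj w z (1 - j) = 1 := by
  unfold spectralProj
  rw [← Matrix.add_mul, ← Matrix.mul_add, Matrix.diagonal_add]
  have : (fun k => (Pi.single j 1 : Fin 2 → ℂ) k + (Pi.single (1 - j) 1 : Fin 2 → ℂ) k)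
      = fun _ => 1 := by
    ext k
    fin_cases j <;> fin_cases k <;> simp
  rw [this, Matrix.diagonal_one, Matrix.mul_one, Matrix.mul_nonsing_inv _ hY]

/-- Because of this, the inhomogeneous term of the Volterra equation disappears when the equation is
differentiated. -/
theorem spectralProj_mulVec (hY : IsUnit (Ymat w z).det) (j : Fin 2) :
    spectralProj w z (1 - j) *ᵥ (fun i => Ymat w z i j) = 0 := by
  have h : (fun i => Ymat w z i j) = Ymat w z *ᵥ Pi.single j 1 := by
    ext i
    simp
  rw [h, Matrix.mulVec_mulVec, spectralProj, Matrix.nonsing_inv_mul_cancel_right _ _ hY,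
    ← Matrix.mulVec_mulVec]
  have : Matrix.diagonal (Pi.single (1 - j) 1) *ᵥ (Pi.single j 1 : Fin 2 → ℂ) = 0 := by
    ext k
    fin_cases j <;> fin_cases k <;> simp [Matrix.mulVec_diagonal]
  rw [this, Matrix.mulVec_zero]

/-- The scalar from the right-hand exponential cancels the phase on the `j`-th eigenline and doubles
it on the other one. -/
theorem exp_smul_conj_expSigma3 (w z a : ℂ) (j : Fin 2) :
    Complex.exp (a * sigma3 j j) • (Ymat w z * expSigma3 (-a) * (Ymat w z)⁻¹) =
      spectralProj w z j + Complex.exp (2 * a * sigma3 j j) • spectralProj w z (1 - j) := by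
  unfold spectralProj
  rw [← Matrix.smul_mul, ← Matrix.mul_smul, ← Matrix.smul_mul, ← Matrix.mul_smul,
    ← Matrix.add_mul, ← Matrix.mul_add]
  congr 2
  ext i k
  fin_cases j <;> fin_cases i <;> fin_cases k <;>
    simp [expSigma3, sigma3, ← Complex.exp_add, two_mul]

/-- This is the diagonalisation of `Q_± - αkσ₃` by `Y_±`, with eigenvalues `∓λ` on the first and
second columns, combined with `P_j = 1 - P_{1-j}`. -/
theorem two_lamz_smul_spectralProj (hw : ‖w‖ = u₀) (hz : z ≠ 0) (hγ : gam u₀ z ≠ 0) {α : ℝ}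
    (hα : α ≠ 0) (j : Fin 2) :
    (2 * lamz u₀ z * sigma3 j j) • spectralProj w z (1 - j) =
      (lamz u₀ z * sigma3 j j) • 1 + Qmat w - ((α : ℂ) * kz α u₀ z) • sigma3 := by
  have hα' : (α : ℂ) ≠ 0 := by exact_mod_cast hα
  have hl : lamz u₀ z = z * gam u₀ z / 2 := by
    unfold lamz gam
    field_simp
  have hk : (α : ℂ) * kz α u₀ z = lamz u₀ z - w * conj w / z := by
    rw [mul_conj_of_norm hw]
    unfold kz lamz
    field_simp
    ring
  have hk' : lamz u₀ z = z / 2 + w * conj w / (2 * z) := by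
    rw [mul_conj_of_norm hw]
    unfold lamz
    field_simp
  have hs : ∀ j, (2 * lamz u₀ z * sigma3 j j) • spectralProj w z (1 - j) =
      (z * sigma3 j j) • (Ymat w z * Matrix.diagonal (Pi.single (1 - j) 1) *
        !![1, -(w / z); conj w / z, 1]) := by
    intro j
    rw [spectralProj, Ymat_inv hw, Matrix.mul_smul, smul_smul, hl]
    congr 1
    field_simp
  rw [hs, hk, hk', Ymat_eq]
  ext i k
  fin_cases j <;> fin_cases i <;> fin_cases k <;>
    simp [sigma3, Qmat, diagonal_single_zero, diagonal_single_one] <;> field_simp <;> ring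

end Proj

/-! ### Jost columns as solutions of abstract Volterra equations. -/

/-- The exponent `2ikλ(σ₃)ⱼⱼ` of the Volterra kernel of the `j`-th column. -/
noncomputable def jostExponent (α u₀ : ℝ) (z : ℂ) (j : Fin 2) : ℂ :=
  2 * (Complex.I * kz α u₀ z * lamz u₀ z) * sigma3 j j

/-- The one-parameter group `s ↦ P_j + e^{μs} P_{1-j}` of the Volterra kernel. -/
noncomputable def jostGroup (w z : ℂ) (j : Fin 2) (μ : ℂ) (s : ℝ) :
    (Fin 2 → ℂ) →L[ℝ] (Fin 2 → ℂ) :=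
  mulVecCLM (spectralProj w z j) + Complex.exp (μ * s) • mulVecCLM (spectralProj w z (1 - j))

theorem isBoundedGroup_jostGroup {w z : ℂ} (hY : IsUnit (Ymat w z).det) (j : Fin 2) {μ : ℂ}
    (hμ : 0 ≤ μ.re) :
    IsBoundedGroup (jostGroup w z j μ) (μ • mulVecCLM (spectralProj w z (1 - j)))
      (‖mulVecCLM (spectralProj w z j)‖ + ‖mulVecCLM (spectralProj w z (1 - j))‖ + 1) := by
  have hj : j ≠ 1 - j := by fin_cases j <;> simp
  refine isBoundedGroup_of_projections ?_ ?_ ?_ ?_ ?_ (fun a v => ?_) (fun a v => ?_) hμ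
  · rw [← mulVecCLM_mul, spectralProj_mul hY, if_pos rfl]
  · rw [← mulVecCLM_mul, spectralProj_mul hY, if_pos rfl]
  · rw [← mulVecCLM_mul, spectralProj_mul hY, if_neg hj, mulVecCLM_zero]
  · rw [← mulVecCLM_mul, spectralProj_mul hY, if_neg hj.symm, mulVecCLM_zero]
  · rw [← mulVecCLM_add, spectralProj_add hY, mulVecCLM_one]
  · rw [mulVecCLM_apply, mulVecCLM_apply, Matrix.mulVec_smul]
  · rw [mulVecCLM_apply, mulVecCLM_apply, Matrix.mulVec_smul]

theorem volterraIntegrand_eq (α u₀ : ℝ) (w : ℂ) (v : ℝ → ℂ) (z : ℂ) (j : Fin 2)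
    (f : ℝ → Fin 2 → ℂ) (x y : ℝ) :
    volterraIntegrand α u₀ w v z j f x y =
      jostGroup w z j (jostExponent α u₀ z j) (x - y)
        (mulVecCLM (DeltaX α u₀ z w (v y)) (f y)) := by
  rw [volterraIntegrand, ← Matrix.mulVec_mulVec, ← Matrix.smul_mulVec, exp_smul_conj_expSigma3,
    jostGroup, Matrix.add_mulVec, Matrix.smul_mulVec]
  simp only [_root_.add_apply, _root_.smul_apply, mulVecCLM_apply, jostExponent,
    Complex.ofReal_sub]
  congr 3
  ring

theorem isJostColumn_plus_iff {α u₀ : ℝ} {w : ℂ} {v : ℝ → ℂ} {z : ℂ} {j : Fin 2}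
    {f : ℝ → Fin 2 → ℂ} :
    IsJostColumn α u₀ w .plus v z j f ↔
      IsTailSolution (jostGroup w z j (jostExponent α u₀ z j))
        (fun y => -mulVecCLM (DeltaX α u₀ z w (v y))) (fun i => Ymat w z i j) f := by
  unfold IsJostColumn IsTailSolution
  have h : ∀ x, (fun y => jostGroup w z j (jostExponent α u₀ z j) (x - y)
      ((-mulVecCLM (DeltaX α u₀ z w (v y))) (f y))) =
      fun y => -volterraIntegrand α u₀ w v z j f x y := by
    intro x
    funext y
    rw [volterraIntegrand_eq, _root_.neg_apply, map_neg]
  refine and_congr (forall_congr' fun x => ?_) (and_congr (forall_congr' fun x => ?_) Iff.rfl)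
  · rw [h]
    exact integrable_neg_iff.symm
  · rw [h, integral_neg]
    simp [Side.sign, Side.halfLine]

/-- The reflection `x ↦ -x` sends the left end to the right end and reverses the group, hence the
sign of the exponent; thus one theory serves both ends. -/
theorem isJostColumn_minus_iff {α u₀ : ℝ} {w : ℂ} {v : ℝ → ℂ} {z : ℂ} {j : Fin 2}
    {f : ℝ → Fin 2 → ℂ} :
    IsJostColumn α u₀ w .minus v z j f ↔
      IsTailSolution (jostGroup w z j (-jostExponent α u₀ z j))
        (fun y => mulVecCLM (DeltaX α u₀ z w (v (-y)))) (fun i => Ymat w z i j)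
        (fun x => f (-x)) := by
  unfold IsJostColumn IsTailSolution
  have h : ∀ x, (fun y => jostGroup w z j (-jostExponent α u₀ z j) (x - y)
      ((mulVecCLM (DeltaX α u₀ z w (v (-y)))) (f (-y)))) =
      fun y => volterraIntegrand α u₀ w v z j f (-x) (-y) := by
    intro x
    funext y
    rw [volterraIntegrand_eq]
    simp only [jostGroup]
    congr 4
    push_cast
    ring_nf
  refine and_congr (neg_surjective.forall.trans (forall_congr' fun x => ?_))
    (and_congr (neg_surjective.forall.trans (forall_congr' fun x => ?_)) ?_)
  · rw [h, ← integrableOn_Ici_iff_integrableOn_Ioi, Side.halfLine,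
      ← (Measure.measurePreserving_neg (volume : Measure ℝ)).integrableOn_comp_preimage
        (MeasurableEquiv.neg ℝ).measurableEmbedding]
    simp [Function.comp_def]
  · rw [h, integral_comp_neg_Ioi, Side.sign, one_smul, Side.halfLine]
  · rw [Side.toEnd]
    constructor
    · exact fun hf => hf.comp tendsto_neg_atTop_atBot
    · intro hf
      simpa [Function.comp_def] using hf.comp tendsto_neg_atBot_atTop

theorem DeltaX_eq (α u₀ : ℝ) (z w v : ℂ) :
    DeltaX α u₀ z w v = (Complex.I * kz α u₀ z) • Qmat (v - w) := by
  ext i k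
  fin_cases i <;> fin_cases k <;> simp [DeltaX, Qmat]

/-- The real-linear map `ξ ↦ (v ↦ a Q(ξ) v)`. -/
noncomputable def QmatCLM (a : ℂ) : ℂ →L[ℝ] (Fin 2 → ℂ) →L[ℝ] (Fin 2 → ℂ) :=
  LinearMap.toContinuousLinearMap
    { toFun := fun ξ => mulVecCLM (a • Qmat ξ)
      map_add' := fun ξ η => by
        rw [← mulVecCLM_add, ← smul_add]
        congr 2
        ext i k
        fin_cases i <;> fin_cases k <;> simp [Qmat]
      map_smul' := fun r ξ => by
        ext v i
        fin_cases i <;> simp [Qmat, Matrix.mulVec, dotProduct, Fin.sum_univ_two] <;> ring }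

theorem mulVecCLM_DeltaX (α u₀ : ℝ) (z w v : ℂ) :
    mulVecCLM (DeltaX α u₀ z w v) = QmatCLM (Complex.I * kz α u₀ z) (v - w) := by
  rw [DeltaX_eq]
  rfl

theorem existsUnique_isTailSolution_jostGroup {w z : ℂ} (hY : IsUnit (Ymat w z).det)
    (j : Fin 2) {μ : ℂ} (hμ : 0 ≤ μ.re) {q : ℝ → ℂ} (hq : Continuous q)
    (hi : IntegrableOn (fun x => q x - w) (Ioi 0))
    (L : ℂ →L[ℝ] (Fin 2 → ℂ) →L[ℝ] (Fin 2 → ℂ)) (c : Fin 2 → ℂ) :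
    ∃! f, IsTailSolution (jostGroup w z j μ) (fun y => L (q y - w)) c f := by
  refine (isBoundedGroup_jostGroup hY j hμ).existsUnique_isTailSolution
    (L.continuous.comp (hq.sub continuous_const))
    (fun x => ?_) c
  -- Continuity covers the compact piece between `x` and `0`.
  have hx : IntegrableOn (fun x => q x - w) (Ioi x) := by
    refine IntegrableOn.mono_set (((hq.sub continuous_const).integrableOn_Icc (a := x)
      (b := 0)).union hi) fun y hy => ?_
    rcases le_or_gt y 0 with h | h
    · exact Or.inl ⟨le_of_lt hy, h⟩
    · exact Or.inr h
  exact (L.integrable_comp hx).norm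

/-- Here `kλ = (z² - u₀⁴/z²) / (4α)` and `1/z² = (z^*)²/|z|⁴`, so both terms contribute to the
imaginary part with the same sign. -/
theorem im_kz_mul_lamz (α u₀ : ℝ) (hα : 0 < α) {z : ℂ} (hz : z ≠ 0) :
    ∃ r : ℝ, 0 < r ∧ (kz α u₀ z * lamz u₀ z).im = r * (z.re * z.im) := by
  have hn : 0 < Complex.normSq z := Complex.normSq_pos.2 hz
  refine ⟨(1 + u₀ ^ 4 / Complex.normSq z ^ 2) / (2 * α), by positivity, ?_⟩
  have e : kz α u₀ z * lamz u₀ z =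
      ((1 / (4 * α) : ℝ) : ℂ) * (z ^ 2 - ((u₀ ^ 4 / Complex.normSq z ^ 2 : ℝ) : ℂ) * conj z ^ 2) := by
    have hα' : (α : ℂ) ≠ 0 := by exact_mod_cast hα.ne'
    have hc : conj z ≠ 0 := (map_ne_zero _).2 hz
    unfold kz lamz
    push_cast
    rw [Complex.normSq_eq_conj_mul_self]
    field_simp
    ring
  rw [e]
  simp only [pow_two, Complex.mul_im, Complex.sub_im, Complex.ofReal_re, Complex.ofReal_im,
    Complex.conj_im, Complex.conj_re, Complex.mul_re, Complex.sub_re]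
  field_simp
  ring

theorem re_jostExponent_nonneg {α u₀ : ℝ} (hα : 0 < α) {z : ℂ} (hz : z ≠ 0) {s : Side}
    {j : Fin 2} (h : z ∈ columnDomain s j) : 0 ≤ (-s.sign * jostExponent α u₀ z j).re := by
  obtain ⟨r, hr, e⟩ := im_kz_mul_lamz α u₀ hα hz
  have e' : jostExponent α u₀ z j = Complex.I * (2 * (kz α u₀ z * lamz u₀ z) * sigma3 j j) := by
    unfold jostExponent
    ring
  rw [e']
  cases s <;> fin_cases j <;>
    simp [columnDomain, closedDPlus, closedDMinus, Side.sign, sigma3] at h ⊢ <;>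
    simp [Complex.mul_im] at e <;> rw [e] <;> nlinarith

/-! ### Existence of the Jost columns and their differential equation. -/

section Jost

variable {α u₀ : ℝ} {w : ℂ} {s : Side} {v : ℝ → ℂ} {z : ℂ} {j : Fin 2} {f : ℝ → Fin 2 → ℂ}

theorem existsUnique_isJostColumn (hα : 0 < α) (hz : z ≠ 0) (hY : IsUnit (Ymat w z).det)
    (hv : Continuous v) (hi : IntegrableOn (fun x => v x - w) (s.halfLine 0))
    (h : z ∈ columnDomain s j) : ∃! f, IsJostColumn α u₀ w s v z j f := by
  have hμ := re_jostExponent_nonneg (u₀ := u₀) hα hz h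
  cases s with
  | plus =>
    simp only [isJostColumn_plus_iff]
    simp only [Side.sign, neg_neg, one_mul] at hμ
    simp_rw [mulVecCLM_DeltaX]
    exact existsUnique_isTailSolution_jostGroup hY j hμ hv hi
      (-QmatCLM (Complex.I * kz α u₀ z)) fun i => Ymat w z i j
  | minus =>
    simp only [isJostColumn_minus_iff]
    simp only [Side.sign, neg_mul, one_mul] at hμ
    have hi' : IntegrableOn (fun x => v (-x) - w) (Ioi 0) := by
      rw [← integrableOn_Ici_iff_integrableOn_Ioi]
      rw [Side.halfLine, ← (Measure.measurePreserving_neg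
        (volume : Measure ℝ)).integrableOn_comp_preimage
        (MeasurableEquiv.neg ℝ).measurableEmbedding] at hi
      simpa [Function.comp_def] using hi
    obtain ⟨f, hf, hu⟩ := existsUnique_isTailSolution_jostGroup hY j hμ
      (hv.comp continuous_neg) hi' (QmatCLM (Complex.I * kz α u₀ z)) fun i => Ymat w z i j
    simp only [Function.comp_apply, ← mulVecCLM_DeltaX] at hf hu
    refine ⟨fun x => f (-x), by simpa using hf, fun g hg => ?_⟩
    funext x
    have := congrFun (hu _ hg) (-x)
    simpa using this

/-- The coefficient matrix of the first-order system of the Lax pair in `x`. -/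
noncomputable def laxX (α u₀ : ℝ) (z v : ℂ) : Matrix (Fin 2) (Fin 2) ℂ :=
  (-(Complex.I * α * kz α u₀ z ^ 2)) • sigma3 + (Complex.I * kz α u₀ z) • Qmat v

/-- The asymptotic value `Q_±` cancels between the two terms on the left. What remains of the right
side depends on the potential alone, which is why solutions normalised at opposite ends can be
compared. -/
theorem jostExponent_smul_spectralProj (hα : α ≠ 0) (hz : z ≠ 0) (hw : ‖w‖ = u₀)
    (hγ : gam u₀ z ≠ 0) (v : ℂ) (j : Fin 2) :
    jostExponent α u₀ z j • spectralProj w z (1 - j) + DeltaX α u₀ z w v =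
      (Complex.I * kz α u₀ z * lamz u₀ z * sigma3 j j) • 1 + laxX α u₀ z v := by
  have h : jostExponent α u₀ z j =
      (Complex.I * kz α u₀ z) * (2 * lamz u₀ z * sigma3 j j) := by
    unfold jostExponent
    ring
  rw [h, mul_smul, two_lamz_smul_spectralProj hw hz hγ hα, DeltaX, laxX]
  module

theorem hasDerivAt_of_isJostColumn (hα : 0 < α) (hz : z ≠ 0) (hw : ‖w‖ = u₀)
    (hγ : gam u₀ z ≠ 0) (hv : Continuous v) (h : z ∈ columnDomain s j)
    (hf : IsJostColumn α u₀ w s v z j f) (x : ℝ) :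
    HasDerivAt f ((Complex.I * kz α u₀ z * lamz u₀ z * sigma3 j j) • f x +
      laxX α u₀ z (v x) *ᵥ f x) x := by
  have hY := isUnit_det_Ymat hw hγ
  have hμ := re_jostExponent_nonneg (u₀ := u₀) hα hz h
  have hV : Continuous fun y => mulVecCLM (DeltaX α u₀ z w (v y)) := by
    simp_rw [mulVecCLM_DeltaX]
    exact (ContinuousLinearMap.continuous _).comp (hv.sub continuous_const)
  have e : (Complex.I * kz α u₀ z * lamz u₀ z * sigma3 j j) • f x + laxX α u₀ z (v x) *ᵥ f x =
      jostExponent α u₀ z j • (spectralProj w z (1 - j) *ᵥ (f x - fun i => Ymat w z i j)) +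
        DeltaX α u₀ z w (v x) *ᵥ f x := by
    rw [Matrix.mulVec_sub, spectralProj_mulVec hY, sub_zero, ← Matrix.smul_mulVec,
      ← Matrix.add_mulVec, jostExponent_smul_spectralProj hα.ne' hz hw hγ, Matrix.add_mulVec,
      Matrix.smul_mulVec, Matrix.one_mulVec]
  rw [e]
  cases s with
  | plus =>
    simp only [Side.sign, neg_neg, one_mul] at hμ
    have hV' : Continuous fun y => -mulVecCLM (DeltaX α u₀ z w (v y)) := hV.neg
    convert! (isBoundedGroup_jostGroup hY j hμ).hasDerivAt_of_isTailSolution hV'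
      (isJostColumn_plus_iff.1 hf) x using 1
    exact (sub_neg_eq_add _ _).symm
  | minus =>
    simp only [Side.sign, neg_mul, one_mul] at hμ
    have h1 := (isBoundedGroup_jostGroup hY j hμ).hasDerivAt_of_isTailSolution
      (hV.comp continuous_neg) (isJostColumn_minus_iff.1 hf) (-x)
    have h2 := h1.scomp x (hasDerivAt_neg x)
    simp only [Function.comp_def, neg_neg] at h2
    convert! h2 using 1
    simp [add_comm]

end Jost

/-! ### Transfer of Jost columns along intertwining isomorphisms. -/

section Transfer

variable {α u₀ : ℝ} {w : ℂ} {s : Side} {v : ℝ → ℂ} {z z' : ℂ} {j j' : Fin 2}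
  {f : ℝ → Fin 2 → ℂ}

/-- Only real linearity of `T` is required, since the sign before the integral is real; this admits
complex conjugation. -/
theorem isJostColumn_comp (T : (Fin 2 → ℂ) ≃L[ℝ] (Fin 2 → ℂ))
    (hI : ∀ f x y, volterraIntegrand α u₀ w v z' j' (fun y => T (f y)) x y =
      T (volterraIntegrand α u₀ w v z j f x y))
    (hc : T (fun i => Ymat w z i j) = fun i => Ymat w z' i j')
    (hf : IsJostColumn α u₀ w s v z j f) :
    IsJostColumn α u₀ w s v z' j' fun x => T (f x) := by
  have hI' : ∀ x, volterraIntegrand α u₀ w v z' j' (fun y => T (f y)) x =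
      fun y => T (volterraIntegrand α u₀ w v z j f x y) := fun x => funext (hI f x)
  have hs : ∀ v, T (s.sign • v) = s.sign • T v := by
    intro v
    cases s <;> simp [Side.sign]
  refine ⟨fun x => ?_, fun x => ?_, ?_⟩
  · rw [hI']
    exact T.toContinuousLinearMap.integrable_comp (hf.1 x)
  · rw [hI', T.integral_comp_comm, ← hs, ← hc, ← map_add, ← hf.2.1 x]
  · rw [← hc]
    exact (T.continuous.tendsto _).comp hf.2.2

theorem isJostColumn_comp_iff (T : (Fin 2 → ℂ) ≃L[ℝ] (Fin 2 → ℂ))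
    (hI : ∀ f x y, volterraIntegrand α u₀ w v z' j' (fun y => T (f y)) x y =
      T (volterraIntegrand α u₀ w v z j f x y))
    (hc : T (fun i => Ymat w z i j) = fun i => Ymat w z' i j') :
    IsJostColumn α u₀ w s v z' j' f ↔ IsJostColumn α u₀ w s v z j fun x => T.symm (f x) := by
  constructor
  · refine isJostColumn_comp T.symm (fun f x y => ?_) (by rw [← hc, T.symm_apply_apply])
    rw [T.eq_symm_apply, ← hI]
    simp only [T.apply_symm_apply]
  · intro hf
    simpa using isJostColumn_comp T hI hc hf

theorem jostColumn_spec {w : Side → ℂ} {u : ℝ → ℝ → ℂ} {t : ℝ}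
    (h : ∃! f, IsJostColumn α u₀ (w s) s (fun x => u x t) z j f) :
    IsJostColumn α u₀ (w s) s (fun x => u x t) z j (jostColumn α u₀ w s u t z j) := by
  rw [jostColumn, dif_pos h]
  exact h.choose_spec.1

/-- Unique solvability holds at both parameters or at neither, and `T 0 = 0` matches the default
values. The symmetries therefore need no condition on the region of `z`. -/
theorem jostColumn_comp {w : Side → ℂ} {u : ℝ → ℝ → ℂ} {t : ℝ}
    (T : (Fin 2 → ℂ) ≃L[ℝ] (Fin 2 → ℂ))
    (hI : ∀ f x y, volterraIntegrand α u₀ (w s) (fun x => u x t) z' j' (fun y => T (f y)) x y =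
      T (volterraIntegrand α u₀ (w s) (fun x => u x t) z j f x y))
    (hc : T (fun i => Ymat (w s) z i j) = fun i => Ymat (w s) z' i j') (x : ℝ) :
    jostColumn α u₀ w s u t z' j' x = T (jostColumn α u₀ w s u t z j x) := by
  have hiff := fun f => isJostColumn_comp_iff (s := s) (f := f) T hI hc
  by_cases h : ∃! f, IsJostColumn α u₀ (w s) s (fun x => u x t) z j f
  · have h' : ∃! f, IsJostColumn α u₀ (w s) s (fun x => u x t) z' j' f := by
      obtain ⟨f, hf, hu⟩ := h
      refine ⟨fun x => T (f x), isJostColumn_comp T hI hc hf, fun g hg => ?_⟩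
      funext x
      rw [← T.symm_apply_eq]
      exact congrFun (hu _ ((hiff g).1 hg)) x
    exact congrFun (h'.unique (jostColumn_spec h')
      (isJostColumn_comp T hI hc (jostColumn_spec h))) x
  · have h' : ¬ ∃! f, IsJostColumn α u₀ (w s) s (fun x => u x t) z' j' f := by
      rintro ⟨f, hf, hu⟩
      refine h ⟨fun x => T.symm (f x), (hiff f).1 hf, fun g hg => ?_⟩
      funext x
      rw [T.eq_symm_apply]
      exact congrFun (hu _ (isJostColumn_comp T hI hc hg)) x
    simp [jostColumn, h, h']

end Transfer

/-! ### Behaviour of `k`, `λ`, `γ` and the projections under the symmetries. -/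

section SpectralFunctions

variable (α u₀ : ℝ) (z : ℂ)

theorem kz_conj : kz α u₀ (conj z) = conj (kz α u₀ z) := by
  simp only [kz, map_div₀, map_sub, map_mul, map_pow, map_ofNat, Complex.conj_ofReal]

theorem lamz_conj : lamz u₀ (conj z) = conj (lamz u₀ z) := by
  simp only [lamz, map_div₀, map_add, map_pow, map_ofNat, Complex.conj_ofReal]

theorem gam_conj : gam u₀ (conj z) = conj (gam u₀ z) := by simp [gam]

theorem kz_neg : kz α u₀ (-z) = -kz α u₀ z := by
  simp only [kz, div_neg]
  ring

theorem lamz_neg : lamz u₀ (-z) = -lamz u₀ z := by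
  simp only [lamz, div_neg]
  ring

theorem gam_neg : gam u₀ (-z) = gam u₀ z := by simp [gam]

variable {u₀ z}

theorem kz_inversion (hu₀ : u₀ ≠ 0) (hz : z ≠ 0) : kz α u₀ (-(u₀ : ℂ) ^ 2 / z) = kz α u₀ z := by
  have hu : (u₀ : ℂ) ≠ 0 := by exact_mod_cast hu₀
  unfold kz
  congr 1
  field_simp
  ring

theorem lamz_inversion (hu₀ : u₀ ≠ 0) (hz : z ≠ 0) :
    lamz u₀ (-(u₀ : ℂ) ^ 2 / z) = -lamz u₀ z := by
  have hu : (u₀ : ℂ) ≠ 0 := by exact_mod_cast hu₀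
  unfold lamz
  field_simp
  ring

theorem gam_inversion (hu₀ : u₀ ≠ 0) (hz : z ≠ 0) :
    gam u₀ (-(u₀ : ℂ) ^ 2 / z) = z ^ 2 / (u₀ : ℂ) ^ 2 * gam u₀ z := by
  have hu : (u₀ : ℂ) ≠ 0 := by exact_mod_cast hu₀
  unfold gam
  field_simp
  ring

theorem sigma3_sub (j : Fin 2) : sigma3 (1 - j) (1 - j) = -sigma3 j j := by
  fin_cases j <;> simp [sigma3]

theorem spectralProj_zero {w : ℂ} (hw : ‖w‖ = u₀) :
    spectralProj w z 0 = (gam u₀ z)⁻¹ • !![1, -(w / z); -(conj w / z), w * conj w / z ^ 2] := by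
  rw [spectralProj, Ymat_inv hw, Matrix.mul_smul, Ymat_eq]
  congr 1
  rw [diagonal_single_zero]
  ext i k
  fin_cases i <;> fin_cases k <;> simp
  ring

theorem spectralProj_one {w : ℂ} (hw : ‖w‖ = u₀) :
    spectralProj w z 1 = (gam u₀ z)⁻¹ • !![w * conj w / z ^ 2, w / z; conj w / z, 1] := by
  rw [spectralProj, Ymat_inv hw, Matrix.mul_smul, Ymat_eq]
  congr 1
  rw [diagonal_single_one]
  ext i k
  fin_cases i <;> fin_cases k <;> simp
  ring

end SpectralFunctions

/-! ### The symmetries `z ↦ z^*` and `z ↦ -z^*`. -/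

section Conjugation

/-- The map `v ↦ (a v₁^*, b v₀^*)` for signs `a` and `b`. -/
noncomputable def conjSwap (a b : ℝ) (ha : a * a = 1) (hb : b * b = 1) :
    (Fin 2 → ℂ) ≃L[ℝ] (Fin 2 → ℂ) :=
  LinearEquiv.toContinuousLinearEquiv
    { toFun := fun v => ![a * conj (v 1), b * conj (v 0)]
      map_add' := fun v v' => by
        ext i
        fin_cases i <;> simp [mul_add]
      map_smul' := fun r v => by
        ext i
        fin_cases i <;> simp <;> ring
      invFun := fun v => ![b * conj (v 1), a * conj (v 0)]
      left_inv := fun v => by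
        have ha' : (a : ℂ) * a = 1 := by exact_mod_cast ha
        have hb' : (b : ℂ) * b = 1 := by exact_mod_cast hb
        ext i
        fin_cases i <;> simp [← mul_assoc, ha', hb']
      right_inv := fun v => by
        have ha' : (a : ℂ) * a = 1 := by exact_mod_cast ha
        have hb' : (b : ℂ) * b = 1 := by exact_mod_cast hb
        ext i
        fin_cases i <;> simp [← mul_assoc, ha', hb'] }

theorem conjSwap_apply (a b : ℝ) (ha : a * a = 1) (hb : b * b = 1) (v : Fin 2 → ℂ) :
    conjSwap a b ha hb v = ![a * conj (v 1), b * conj (v 0)] := rfl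

theorem conjSwap_smul (a b : ℝ) (ha : a * a = 1) (hb : b * b = 1) (c : ℂ) (v : Fin 2 → ℂ) :
    conjSwap a b ha hb (c • v) = conj c • conjSwap a b ha hb v := by
  ext i
  fin_cases i <;> simp [conjSwap_apply] <;> ring

/-- `ε = -1` gives the symmetry `z ↦ z^*` and `ε = 1` the symmetry `z ↦ -z^*`. -/
theorem volterraIntegrand_conjSwap {α u₀ : ℝ} {w : ℂ} (hw : ‖w‖ = u₀) (v : ℝ → ℂ) (z : ℂ)
    {ε a b : ℝ} (hε : ε * ε = 1) (ha : a * a = 1) (hb : b * b = 1) (hab : a * b = ε) (j : Fin 2)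
    (f : ℝ → Fin 2 → ℂ) (x y : ℝ) :
    volterraIntegrand α u₀ w v (-ε * conj z) (1 - j) (fun y => conjSwap a b ha hb (f y)) x y =
      conjSwap a b ha hb (volterraIntegrand α u₀ w v z j f x y) := by
  have hk : kz α u₀ (-ε * conj z) = -ε * conj (kz α u₀ z) := by
    rcases mul_self_eq_one_iff.1 hε with rfl | rfl <;> simp [kz_neg, kz_conj]
  have hl : lamz u₀ (-ε * conj z) = -ε * conj (lamz u₀ z) := by
    rcases mul_self_eq_one_iff.1 hε with rfl | rfl <;> simp [lamz_neg, lamz_conj]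
  have hg : gam u₀ (-ε * conj z) = conj (gam u₀ z) := by
    rcases mul_self_eq_one_iff.1 hε with rfl | rfl <;> simp [gam_neg, gam_conj]
  have hε' : (ε : ℂ) * ε = 1 := by exact_mod_cast hε
  have hμ : jostExponent α u₀ (-ε * conj z) (1 - j) = conj (jostExponent α u₀ z j) := by
    rw [jostExponent, jostExponent, hk, hl, sigma3_sub]
    have hs : conj (sigma3 j j) = sigma3 j j := by fin_cases j <;> simp [sigma3]
    simp only [map_mul, Complex.conj_I, hs, map_ofNat]
    linear_combination (-2 * Complex.I * conj (kz α u₀ z) * conj (lamz u₀ z) * sigma3 j j) * hε'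
  -- The swap carries each eigenline at `z` to the other eigenline at the new parameter. Only the
  -- product `ab = ε` matters here; the individual signs are fixed later by the normalisation of the
  -- columns.
  have hP : ∀ j (v : Fin 2 → ℂ), spectralProj w (-ε * conj z) (1 - j) *ᵥ conjSwap a b ha hb v =
      conjSwap a b ha hb (spectralProj w z j *ᵥ v) := by
    intro j v
    have h0 : spectralProj w (-ε * conj z) 0 *ᵥ conjSwap a b ha hb v =
        conjSwap a b ha hb (spectralProj w z 1 *ᵥ v) := by
      rw [spectralProj_zero hw, spectralProj_one hw, hg]
      subst hab
      rcases mul_self_eq_one_iff.1 ha with rfl | rfl <;>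
        rcases mul_self_eq_one_iff.1 hb with rfl | rfl <;> ext i <;> fin_cases i <;>
        simp [conjSwap_apply, Matrix.mulVec, dotProduct, Fin.sum_univ_two, div_neg,
          -mul_eq_mul_left_iff, -mul_eq_mul_right_iff] <;> ring
    have h1 : spectralProj w (-ε * conj z) 1 *ᵥ conjSwap a b ha hb v =
        conjSwap a b ha hb (spectralProj w z 0 *ᵥ v) := by
      rw [spectralProj_zero hw, spectralProj_one hw, hg]
      subst hab
      rcases mul_self_eq_one_iff.1 ha with rfl | rfl <;>
        rcases mul_self_eq_one_iff.1 hb with rfl | rfl <;> ext i <;> fin_cases i <;>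
        simp [conjSwap_apply, Matrix.mulVec, dotProduct, Fin.sum_univ_two, div_neg,
          -mul_eq_mul_left_iff, -mul_eq_mul_right_iff] <;> ring
    fin_cases j
    · exact h1
    · exact h0
  have hD : ∀ v' : Fin 2 → ℂ, DeltaX α u₀ (-ε * conj z) w (v y) *ᵥ conjSwap a b ha hb v' =
      conjSwap a b ha hb (DeltaX α u₀ z w (v y) *ᵥ v') := by
    intro v'
    rw [DeltaX_eq, DeltaX_eq, hk]
    subst hab
    rcases mul_self_eq_one_iff.1 ha with rfl | rfl <;>
      rcases mul_self_eq_one_iff.1 hb with rfl | rfl <;> ext i <;> fin_cases i <;>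
      simp [conjSwap_apply, Qmat, Matrix.mulVec, dotProduct, Fin.sum_univ_two]
  rw [volterraIntegrand_eq, volterraIntegrand_eq, hμ]
  simp only [jostGroup, _root_.add_apply, _root_.smul_apply, mulVecCLM_apply, map_add,
    conjSwap_smul, hD, hP, ← Complex.exp_conj, map_mul, Complex.conj_ofReal]

variable {α u₀ : ℝ} {w : Side → ℂ} {s : Side} {u : ℝ → ℝ → ℂ} {t : ℝ}

theorem jostColumn_one_conj (hw : ‖w s‖ = u₀) {ε : ℝ} (hε : ε * ε = 1) (z : ℂ) (x : ℝ) :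
    jostColumn α u₀ w s u t (-ε * conj z) 1 x =
      ![ε * conj (jostColumn α u₀ w s u t z 0 x 1), conj (jostColumn α u₀ w s u t z 0 x 0)] := by
  rw [jostColumn_comp (z := z) (j := 0) (j' := 1) (conjSwap ε 1 hε (one_mul 1))
    (volterraIntegrand_conjSwap hw _ z hε hε (one_mul 1) (mul_one ε) 0)]
  · simp [conjSwap_apply]
  · rw [conjSwap_apply, Ymat_eq, Ymat_eq]
    ext i
    rcases mul_self_eq_one_iff.1 hε with rfl | rfl <;> fin_cases i <;> simp [div_neg]

theorem jostColumn_zero_conj (hw : ‖w s‖ = u₀) {ε : ℝ} (hε : ε * ε = 1) (z : ℂ) (x : ℝ) :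
    jostColumn α u₀ w s u t (-ε * conj z) 0 x =
      ![conj (jostColumn α u₀ w s u t z 1 x 1), ε * conj (jostColumn α u₀ w s u t z 1 x 0)] := by
  rw [jostColumn_comp (z := z) (j := 1) (j' := 0) (conjSwap 1 ε (one_mul 1) hε)
    (volterraIntegrand_conjSwap hw _ z hε (one_mul 1) hε (one_mul ε) 1)]
  · simp [conjSwap_apply]
  · rw [conjSwap_apply, Ymat_eq, Ymat_eq]
    ext i
    rcases mul_self_eq_one_iff.1 hε with rfl | rfl <;> fin_cases i <;> simp [div_neg]

theorem cconj_eq (A : Matrix (Fin 2) (Fin 2) ℂ) :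
    cconj A = !![conj (A 0 0), conj (A 0 1); conj (A 1 0), conj (A 1 1)] :=
  (cconj A).eta_fin_two

theorem neg_sigmaStar_mul_cconj_mul (A : Matrix (Fin 2) (Fin 2) ℂ) :
    -(sigmaStar * cconj A * sigmaStar) =
      !![conj (A 1 1), -conj (A 1 0); -conj (A 0 1), conj (A 0 0)] := by
  rw [cconj_eq]
  ext i j
  fin_cases i <;> fin_cases j <;> simp [sigmaStar]

theorem sigma1_mul_cconj_mul (A : Matrix (Fin 2) (Fin 2) ℂ) :
    sigma1 * cconj A * sigma1 = !![conj (A 1 1), conj (A 1 0); conj (A 0 1), conj (A 0 0)] := by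
  rw [cconj_eq]
  ext i j
  fin_cases i <;> fin_cases j <;> simp [sigma1]

theorem jost_conj (hw : ‖w s‖ = u₀) (x : ℝ) (z : ℂ) :
    jost α u₀ w s u x t z = -(sigmaStar * cconj (jost α u₀ w s u x t (conj z)) * sigmaStar) := by
  have h0 := jostColumn_zero_conj (α := α) (u := u) (t := t) hw (ε := -1) (by norm_num) (conj z) x
  have h1 := jostColumn_one_conj (α := α) (u := u) (t := t) hw (ε := -1) (by norm_num) (conj z) x
  simp only [Complex.ofReal_neg, Complex.ofReal_one, neg_neg, one_mul, Complex.conj_conj,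
    neg_mul] at h0 h1
  rw [neg_sigmaStar_mul_cconj_mul]
  ext i j
  fin_cases i <;> fin_cases j <;> simp [jost, h0, h1]

theorem jost_neg_conj (hw : ‖w s‖ = u₀) (x : ℝ) (z : ℂ) :
    jost α u₀ w s u x t z = sigma1 * cconj (jost α u₀ w s u x t (-conj z)) * sigma1 := by
  have h0 := jostColumn_zero_conj (α := α) (u := u) (t := t) hw (ε := 1) (by norm_num)
    (-conj z) x
  have h1 := jostColumn_one_conj (α := α) (u := u) (t := t) hw (ε := 1) (by norm_num)
    (-conj z) x
  simp only [Complex.ofReal_one, neg_neg, one_mul, Complex.conj_conj, neg_mul, map_neg] at h0 h1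
  rw [sigma1_mul_cconj_mul]
  ext i j
  fin_cases i <;> fin_cases j <;> simp [jost, h0, h1]

end Conjugation

/-! ### The symmetry `z ↦ -u₀² / z`. -/

section Inversion

/-- Multiplication by a nonzero complex number. -/
noncomputable def smulCLE (c : ℂ) (hc : c ≠ 0) : (Fin 2 → ℂ) ≃L[ℝ] (Fin 2 → ℂ) :=
  ContinuousLinearEquiv.piCongrRight fun _ =>
    (ContinuousLinearEquiv.unitsEquivAut ℂ (Units.mk0 c hc)).restrictScalars ℝ

theorem smulCLE_apply (c : ℂ) (hc : c ≠ 0) (v : Fin 2 → ℂ) : smulCLE c hc v = c • v := by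
  ext i
  simp [smulCLE, mul_comm]

theorem volterraIntegrand_inversion {α u₀ : ℝ} {w : ℂ} (hw : ‖w‖ = u₀) (hu₀ : u₀ ≠ 0)
    (v : ℝ → ℂ) {z : ℂ} (hz : z ≠ 0) (hγ : gam u₀ z ≠ 0) (c : ℂ) (hc : c ≠ 0) (j : Fin 2)
    (f : ℝ → Fin 2 → ℂ) (x y : ℝ) :
    volterraIntegrand α u₀ w v z (1 - j) (fun y => smulCLE c hc (f y)) x y =
      smulCLE c hc (volterraIntegrand α u₀ w v (-(u₀ : ℂ) ^ 2 / z) j f x y) := by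
  have hu : (u₀ : ℂ) ≠ 0 := by exact_mod_cast hu₀
  have hww := mul_conj_of_norm hw
  have hw0 : w ≠ 0 := by
    rintro rfl
    simp at hw
    exact hu₀ hw.symm
  have hw0' : conj w ≠ 0 := (map_ne_zero _).2 hw0
  have hμ : jostExponent α u₀ (-(u₀ : ℂ) ^ 2 / z) j = jostExponent α u₀ z (1 - j) := by
    rw [jostExponent, jostExponent, kz_inversion α hu₀ hz, lamz_inversion hu₀ hz, sigma3_sub]
    ring
  -- The columns of `Y` at the two parameters span the same two lines in opposite order. The
  -- equations coincide after relabelling, so every scalar `c` intertwines them.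
  have hP : ∀ j, spectralProj w (-(u₀ : ℂ) ^ 2 / z) j = spectralProj w z (1 - j) := by
    intro j
    fin_cases j
    · change spectralProj w _ 0 = spectralProj w z 1
      rw [spectralProj_zero hw, spectralProj_one hw, gam_inversion hu₀ hz, ← hww]
      ext i k
      fin_cases i <;> fin_cases k <;> simp <;> field_simp
    · change spectralProj w _ 1 = spectralProj w z 0
      rw [spectralProj_zero hw, spectralProj_one hw, gam_inversion hu₀ hz, ← hww]
      ext i k
      fin_cases i <;> fin_cases k <;> simp <;> field_simp
  have hD : DeltaX α u₀ (-(u₀ : ℂ) ^ 2 / z) w (v y) = DeltaX α u₀ z w (v y) := by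
    rw [DeltaX, DeltaX, kz_inversion α hu₀ hz]
  rw [volterraIntegrand_eq, volterraIntegrand_eq, hμ, hD]
  simp only [jostGroup, hP, _root_.add_apply, _root_.smul_apply, mulVecCLM_apply, smulCLE_apply,
    Matrix.mulVec_smul, smul_add]
  rw [smul_comm c]

theorem jost_inversion {α u₀ : ℝ} {w : Side → ℂ} {s : Side} {u : ℝ → ℝ → ℂ} {t : ℝ}
    (hw : ‖w s‖ = u₀) (hu₀ : u₀ ≠ 0) {z : ℂ} (hz : z ≠ 0) (hγ : gam u₀ z ≠ 0) (x : ℝ) :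
    jost α u₀ w s u x t z =
      z⁻¹ • (jost α u₀ w s u x t (-(u₀ : ℂ) ^ 2 / z) * (sigma3 * Qmat (w s))) := by
  have hww := mul_conj_of_norm hw
  have hw0 : w s ≠ 0 := by
    intro h
    simp [h] at hw
    exact hu₀ hw.symm
  have hw0' : conj (w s) ≠ 0 := (map_ne_zero _).2 hw0
  -- The scalars are forced by the columns of `Y`; they are the nonzero entries of `z⁻¹ σ₃ Q_±`.
  have hc0 : -(conj (w s) / z) ≠ 0 := neg_ne_zero.2 (div_ne_zero hw0' hz)
  have hc1 : w s / z ≠ 0 := div_ne_zero hw0 hz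
  have h0 : jostColumn α u₀ w s u t z 0 x =
      -(conj (w s) / z) • jostColumn α u₀ w s u t (-(u₀ : ℂ) ^ 2 / z) 1 x := by
    rw [← smulCLE_apply _ hc0]
    refine jostColumn_comp _ (volterraIntegrand_inversion hw hu₀ _ hz hγ _ hc0 1) ?_ x
    rw [smulCLE_apply, Ymat_eq, Ymat_eq, ← hww]
    ext i
    fin_cases i <;> simp
    field_simp
  have h1 : jostColumn α u₀ w s u t z 1 x =
      (w s / z) • jostColumn α u₀ w s u t (-(u₀ : ℂ) ^ 2 / z) 0 x := by
    rw [← smulCLE_apply _ hc1]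
    refine jostColumn_comp _ (volterraIntegrand_inversion hw hu₀ _ hz hγ _ hc1 0) ?_ x
    rw [smulCLE_apply, Ymat_eq, Ymat_eq, ← hww]
    ext i
    fin_cases i <;> simp
    field_simp
  ext i j
  fin_cases i <;> fin_cases j <;>
    simp [jost, sigma3, Qmat, h0, h1, Matrix.mul_apply, Fin.sum_univ_two] <;> ring

end Inversion

/-! ### The Lax system, Wronskians and the scattering matrix. -/

section Lax

variable {α u₀ : ℝ} {w : Side → ℂ} {u : ℝ → ℝ → ℂ} {t : ℝ} {z : ℂ}

theorem laxJost_apply (s : Side) (x : ℝ) (z : ℂ) (i j : Fin 2) :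
    laxJost α u₀ w s u x t z i j =
      jost α u₀ w s u x t z i j * Complex.exp (Complex.I * theta α u₀ x t z * sigma3 j j) := by
  rw [laxJost, Matrix.mul_apply, Fin.sum_univ_two]
  fin_cases j <;> simp [expSigma3, sigma3]

theorem theta_conj (α u₀ x t : ℝ) (z : ℂ) :
    theta α u₀ x t (conj z) = conj (theta α u₀ x t z) := by
  simp only [theta, kz_conj, lamz_conj, map_mul, map_neg, map_add, map_sub, map_pow, map_div₀,
    map_ofNat, Complex.conj_ofReal]

theorem theta_neg (α u₀ x t : ℝ) (z : ℂ) : theta α u₀ x t (-z) = theta α u₀ x t z := by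
  simp only [theta, kz_neg, lamz_neg, neg_mul_neg, neg_sq]

theorem theta_inversion (α x t : ℝ) (hu₀ : u₀ ≠ 0) (hz : z ≠ 0) :
    theta α u₀ x t (-(u₀ : ℂ) ^ 2 / z) = -theta α u₀ x t z := by
  simp only [theta, kz_inversion α hu₀ hz, lamz_inversion hu₀ hz]
  ring

theorem hasDerivAt_theta (α u₀ x t : ℝ) (z : ℂ) :
    HasDerivAt (fun x : ℝ => theta α u₀ x t z) (-(kz α u₀ z * lamz u₀ z)) x := by
  have h := ((hasDerivAt_id (x : ℂ)).comp_ofReal.add_const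
    ((2 * (α : ℂ) * kz α u₀ z ^ 2 - 4 * (α : ℂ) - (u₀ : ℂ) ^ 2 / (α : ℂ)) * (t : ℂ))).const_mul
    (-(kz α u₀ z * lamz u₀ z))
  simpa [theta] using h

theorem laxJost_conj (hw : ∀ s, ‖w s‖ = u₀) (s : Side) (x : ℝ) (z : ℂ) :
    laxJost α u₀ w s u x t z =
      -(sigmaStar * cconj (laxJost α u₀ w s u x t (conj z)) * sigmaStar) := by
  have h := jost_conj (α := α) (u := u) (t := t) (hw s) x z
  rw [neg_sigmaStar_mul_cconj_mul] at h ⊢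
  ext i j
  have h' := congrFun (congrFun h i) j
  rw [laxJost_apply, h']
  fin_cases i <;> fin_cases j <;>
    simp [laxJost_apply, theta_conj, sigma3, ← Complex.exp_conj]

theorem laxJost_neg_conj (hw : ∀ s, ‖w s‖ = u₀) (s : Side) (x : ℝ) (z : ℂ) :
    laxJost α u₀ w s u x t z =
      sigma1 * cconj (laxJost α u₀ w s u x t (-conj z)) * sigma1 := by
  have h := jost_neg_conj (α := α) (u := u) (t := t) (hw s) x z
  rw [sigma1_mul_cconj_mul] at h ⊢
  ext i j
  have h' := congrFun (congrFun h i) j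
  rw [laxJost_apply, h']
  fin_cases i <;> fin_cases j <;>
    simp [laxJost_apply, theta_conj, theta_neg, sigma3, ← Complex.exp_conj]

theorem smul_mul_sigma3_mul_Qmat (A : Matrix (Fin 2) (Fin 2) ℂ) (c v : ℂ) :
    c • (A * (sigma3 * Qmat v)) =
      !![-(c * conj v * A 0 1), c * v * A 0 0; -(c * conj v * A 1 1), c * v * A 1 0] := by
  ext i j
  fin_cases i <;> fin_cases j <;>
    simp [sigma3, Qmat, Matrix.mul_apply, Fin.sum_univ_two] <;> ring

theorem laxJost_inversion (hw : ∀ s, ‖w s‖ = u₀) (hu₀ : u₀ ≠ 0) (hz : z ≠ 0)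
    (hγ : gam u₀ z ≠ 0) (s : Side) (x : ℝ) :
    laxJost α u₀ w s u x t z =
      z⁻¹ • (laxJost α u₀ w s u x t (-(u₀ : ℂ) ^ 2 / z) * (sigma3 * Qmat (w s))) := by
  have h := jost_inversion (α := α) (u := u) (t := t) (hw s) hu₀ hz hγ x
  rw [smul_mul_sigma3_mul_Qmat] at h ⊢
  ext i j
  have h' := congrFun (congrFun h i) j
  rw [laxJost_apply, h']
  fin_cases i <;> fin_cases j <;>
    simp [laxJost_apply, theta_inversion α x t hu₀ hz, sigma3] <;> ring

theorem scatteringMatrix_conj (hw : ∀ s, ‖w s‖ = u₀) (z : ℂ) :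
    scatteringMatrix α u₀ w u t z =
      -(sigmaStar * cconj (scatteringMatrix α u₀ w u t (conj z)) * sigmaStar) := by
  have hL := fun s => (laxJost_conj (α := α) (u := u) (t := t) hw s 0 z).trans
    (neg_sigmaStar_mul_cconj_mul _)
  rw [neg_sigmaStar_mul_cconj_mul, scatteringMatrix, hL, hL, scatteringMatrix, gam_conj]
  ext i j
  fin_cases i <;> fin_cases j <;> simp [wr, -mul_eq_mul_left_iff] <;> ring

theorem scatteringMatrix_neg_conj (hw : ∀ s, ‖w s‖ = u₀) (z : ℂ) :
    scatteringMatrix α u₀ w u t z =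
      sigma1 * cconj (scatteringMatrix α u₀ w u t (-conj z)) * sigma1 := by
  have hL := fun s => (laxJost_neg_conj (α := α) (u := u) (t := t) hw s 0 z).trans
    (sigma1_mul_cconj_mul _)
  rw [sigma1_mul_cconj_mul, scatteringMatrix, hL, hL, scatteringMatrix, gam_neg, gam_conj]
  ext i j
  fin_cases i <;> fin_cases j <;> simp [wr, -mul_eq_mul_left_iff] <;> ring

theorem sigma3_mul_Qmat_inv {v : ℂ} (hv : v ≠ 0) :
    (sigma3 * Qmat v)⁻¹ = !![0, -(conj v)⁻¹; v⁻¹, 0] := by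
  have hv' : conj v ≠ 0 := (map_ne_zero _).2 hv
  apply Matrix.inv_eq_right_inv
  ext i j
  fin_cases i <;> fin_cases j <;>
    simp [sigma3, Qmat, hv, hv']

theorem sigma3_mul_Qmat_inv_mul_mul {v : ℂ} (hv : v ≠ 0) (v' : ℂ)
    (A : Matrix (Fin 2) (Fin 2) ℂ) :
    (sigma3 * Qmat v)⁻¹ * A * (sigma3 * Qmat v') =
      !![conj v' / conj v * A 1 1, -(v' / conj v * A 1 0);
        -(conj v' / v * A 0 1), v' / v * A 0 0] := by
  rw [sigma3_mul_Qmat_inv hv]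
  nth_rewrite 1 [A.eta_fin_two]
  ext i j
  fin_cases i <;> fin_cases j <;> simp [sigma3, Qmat] <;> ring

theorem scatteringMatrix_inversion (hw : ∀ s, ‖w s‖ = u₀) (hu₀ : u₀ ≠ 0) (hz : z ≠ 0)
    (hγ : gam u₀ z ≠ 0) :
    scatteringMatrix α u₀ w u t z =
      (sigma3 * Qmat (w .minus))⁻¹ * scatteringMatrix α u₀ w u t (-(u₀ : ℂ) ^ 2 / z) *
        (sigma3 * Qmat (w .plus)) := by
  have hL := fun s => (laxJost_inversion (α := α) (u := u) (t := t) hw hu₀ hz hγ s 0).trans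
    (smul_mul_sigma3_mul_Qmat _ _ _)
  have hw0 : ∀ s, w s ≠ 0 := fun s h => hu₀ (by rw [← hw s, h, norm_zero])
  have hw0' : conj (w .minus) ≠ 0 := (map_ne_zero _).2 (hw0 _)
  rw [sigma3_mul_Qmat_inv_mul_mul (hw0 _), scatteringMatrix, hL, hL, scatteringMatrix,
    gam_inversion hu₀ hz, ← mul_conj_of_norm (hw .minus)]
  have hm := hw0 .minus
  ext i j
  fin_cases i <;> fin_cases j <;> simp [wr] <;> field_simp <;> ring

/-- Since `θ' = -kλ`, the factor `e^{iθσ₃}` absorbs the column-dependent term `ikλ(σ₃)_jj`. -/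
theorem hasDerivAt_laxJost (hα : 0 < α) (hw : ∀ s, ‖w s‖ = u₀) (hz : z ≠ 0) (hγ : gam u₀ z ≠ 0)
    (hu : Continuous fun x => u x t) {s : Side} {j : Fin 2}
    (hs : z ∈ columnDomain s j)
    (h : ∃! f, IsJostColumn α u₀ (w s) s (fun x => u x t) z j f) (x : ℝ) (i : Fin 2) :
    HasDerivAt (fun x => laxJost α u₀ w s u x t z i j)
      (laxX α u₀ z (u x t) i 0 * laxJost α u₀ w s u x t z 0 j +
        laxX α u₀ z (u x t) i 1 * laxJost α u₀ w s u x t z 1 j) x := by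
  have hf := hasDerivAt_pi.1 (hasDerivAt_of_isJostColumn hα hz (hw s) hγ hu hs
    (jostColumn_spec h) x) i
  have he := (((hasDerivAt_theta α u₀ x t z).const_mul Complex.I).mul_const (sigma3 j j)).cexp
  simp only [laxJost_apply, jost, Matrix.of_apply]
  convert! hf.mul he using 1
  simp only [Pi.add_apply, Pi.smul_apply, Matrix.mulVec, dotProduct, Fin.sum_univ_two, smul_eq_mul]
  ring

/-- Liouville's formula for a trace-free system. -/
theorem wr_laxJost_eq (hα : 0 < α) (hw : ∀ s, ‖w s‖ = u₀) (hz : z ≠ 0) (hγ : gam u₀ z ≠ 0)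
    (hu : Continuous fun x => u x t) {s s' : Side} {j j' : Fin 2} (hs : z ∈ columnDomain s j)
    (hs' : z ∈ columnDomain s' j')
    (h : ∃! f, IsJostColumn α u₀ (w s) s (fun x => u x t) z j f)
    (h' : ∃! f, IsJostColumn α u₀ (w s') s' (fun x => u x t) z j' f) (x y : ℝ) :
    wr (laxJost α u₀ w s u x t z) j (laxJost α u₀ w s' u x t z) j' =
      wr (laxJost α u₀ w s u y t z) j (laxJost α u₀ w s' u y t z) j' := by
  have hd : ∀ x, HasDerivAt (fun x => wr (laxJost α u₀ w s u x t z) j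
      (laxJost α u₀ w s' u x t z) j') 0 x := by
    intro x
    have H := hasDerivAt_laxJost hα hw hz hγ hu hs h x
    have H' := hasDerivAt_laxJost hα hw hz hγ hu hs' h' x
    convert! ((H 0).mul (H' 1)).sub ((H 1).mul (H' 0)) using 1
    simp [laxX, sigma3, Qmat]
    ring
  exact is_const_of_deriv_eq_zero (fun x => (hd x).differentiableAt) (fun x => (hd x).deriv) x y

theorem wr_laxJost_zero_one (s s' : Side) (x : ℝ) :
    wr (laxJost α u₀ w s u x t z) 0 (laxJost α u₀ w s' u x t z) 1 =
      wr (jost α u₀ w s u x t z) 0 (jost α u₀ w s' u x t z) 1 := by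
  have h : Complex.exp (Complex.I * theta α u₀ x t z) *
      Complex.exp (-(Complex.I * theta α u₀ x t z)) = 1 := by
    rw [← Complex.exp_add, add_neg_cancel, Complex.exp_zero]
  simp only [wr, laxJost_apply, sigma3, Matrix.of_apply, Matrix.cons_val', Matrix.cons_val_zero,
    Matrix.cons_val_one, Matrix.cons_val_fin_one, mul_one, mul_neg]
  linear_combination (jost α u₀ w s u x t z 0 0 * jost α u₀ w s' u x t z 1 1 -
    jost α u₀ w s u x t z 1 0 * jost α u₀ w s' u x t z 0 1) * h

theorem toEnd_neBot (s : Side) : s.toEnd.NeBot := by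
  cases s <;> simp only [Side.toEnd] <;> infer_instance

/-- The Wronskian is constant and, the phases of the two columns being inverse, equals that of the
normalised columns; it is read off in the limit as `det Y_±`. -/
theorem wr_laxJost_self (hα : 0 < α) (hw : ∀ s, ‖w s‖ = u₀) (hz : z ≠ 0) (hγ : gam u₀ z ≠ 0)
    (hu : Continuous fun x => u x t) {s : Side} (hs : ∀ j, z ∈ columnDomain s j)
    (h : ∀ j, ∃! f, IsJostColumn α u₀ (w s) s (fun x => u x t) z j f) (x : ℝ) :
    wr (laxJost α u₀ w s u x t z) 0 (laxJost α u₀ w s u x t z) 1 = gam u₀ z := by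
  have := toEnd_neBot s
  have hlim : ∀ i j, Tendsto (fun x => jost α u₀ w s u x t z i j) s.toEnd
      (𝓝 (Ymat (w s) z i j)) := fun i j => (tendsto_pi_nhds.1 (jostColumn_spec (h j)).2.2) i
  have h1 := ((hlim 0 0).mul (hlim 1 1)).sub ((hlim 1 0).mul (hlim 0 1))
  rw [mul_comm (Ymat (w s) z 1 0), ← Matrix.det_fin_two, det_Ymat (hw s)] at h1
  refine tendsto_nhds_unique (f := fun _ : ℝ => _) (l := s.toEnd) tendsto_const_nhds
    (h1.congr fun y => ?_)
  rw [wr_laxJost_eq hα hw hz hγ hu (hs 0) (hs 1) (h 0) (h 1) x y, wr_laxJost_zero_one, wr]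

end Lax

end MNLS

/-! ### Assembly of the main theorem. -/

open MNLS
theorem mainTheorem3 (α u₀ : ℝ) (hα : 0 < α) (hu₀ : 0 < u₀)
    (w : Side → ℂ) (hw : ∀ s, ‖w s‖ = u₀)
    (u : ℝ → ℝ → ℂ) (hcont : ∀ t, Continuous fun x => u x t)
    (hminus : ∀ t, IntegrableOn (fun x => u x t - w .minus) (Iic 0))
    (hplus : ∀ t, IntegrableOn (fun x => u x t - w .plus) (Ici 0))
    (t : ℝ) (z : ℂ) (hz : z ≠ 0) (hz' : z ^ 2 ≠ -(u₀ : ℂ) ^ 2) :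
    -- the columns of the Jost solutions are well defined on their regions
    (∀ s j, z ∈ columnDomain s j →
      ∃! f, IsJostColumn α u₀ (w s) s (fun x => u x t) z j f) ∧
    -- on the contour, `S` is the matrix that relates the two Jost solutions
    (z ∈ contour →
      (∀ x, laxJost α u₀ w .plus u x t z =
        laxJost α u₀ w .minus u x t z * scatteringMatrix α u₀ w u t z) ∧
      ∀ S : Matrix (Fin 2) (Fin 2) ℂ,
        (∀ x, laxJost α u₀ w .plus u x t z = laxJost α u₀ w .minus u x t z * S) →
          S = scatteringMatrix α u₀ w u t z) ∧
    -- off the contour, `s₁₁` and `s₂₂` are Wronskians that do not depend on `x`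
    (z ∈ closedDPlus → ∀ x, scatteringMatrix α u₀ w u t z 0 0 =
      wr (jost α u₀ w .plus u x t z) 0 (jost α u₀ w .minus u x t z) 1 / gam u₀ z) ∧
    (z ∈ closedDMinus → ∀ x, scatteringMatrix α u₀ w u t z 1 1 =
      wr (jost α u₀ w .minus u x t z) 0 (jost α u₀ w .plus u x t z) 1 / gam u₀ z) ∧
    -- first symmetry, `z ↦ z^*`
    (∀ s x, jost α u₀ w s u x t z =
      -(sigmaStar * cconj (jost α u₀ w s u x t (conj z)) * sigmaStar)) ∧
    scatteringMatrix α u₀ w u t z =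
      -(sigmaStar * cconj (scatteringMatrix α u₀ w u t (conj z)) * sigmaStar) ∧
    rho α u₀ w u t z = -conj (rhoTilde α u₀ w u t (conj z)) ∧
    -- first symmetry, `z ↦ -z^*`
    (∀ s x, jost α u₀ w s u x t z =
      sigma1 * cconj (jost α u₀ w s u x t (-conj z)) * sigma1) ∧
    scatteringMatrix α u₀ w u t z =
      sigma1 * cconj (scatteringMatrix α u₀ w u t (-conj z)) * sigma1 ∧
    rho α u₀ w u t z = conj (rhoTilde α u₀ w u t (-conj z)) ∧
    -- second symmetry, `z ↦ -u₀² / z`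
    (∀ s x, jost α u₀ w s u x t z =
      z⁻¹ • (jost α u₀ w s u x t (-(u₀ : ℂ) ^ 2 / z) * (sigma3 * Qmat (w s)))) ∧
    scatteringMatrix α u₀ w u t z =
      (sigma3 * Qmat (w .minus))⁻¹ * scatteringMatrix α u₀ w u t (-(u₀ : ℂ) ^ 2 / z) *
        (sigma3 * Qmat (w .plus)) ∧
    rho α u₀ w u t z =
      -(conj (w .minus) / w .minus) * rhoTilde α u₀ w u t (-(u₀ : ℂ) ^ 2 / z) ∧
    -- parity
    scatteringMatrix α u₀ w u t (-z) 0 0 = scatteringMatrix α u₀ w u t z 0 0 ∧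
    scatteringMatrix α u₀ w u t (-z) 1 1 = scatteringMatrix α u₀ w u t z 1 1 ∧
    scatteringMatrix α u₀ w u t (-z) 0 1 = -scatteringMatrix α u₀ w u t z 0 1 ∧
    scatteringMatrix α u₀ w u t (-z) 1 0 = -scatteringMatrix α u₀ w u t z 1 0 := by

  have hγ := gam_ne_zero hz hz'
  have hu0 := hu₀.ne'
  have hwm : w .minus ≠ 0 := fun h => hu0 (by rw [← hw .minus, h, norm_zero])
  have hwp : w .plus ≠ 0 := fun h => hu0 (by rw [← hw .plus, h, norm_zero])
  have hwm' : conj (w .minus) ≠ 0 := (map_ne_zero _).2 hwm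
  have hwp' : conj (w .plus) ≠ 0 := (map_ne_zero _).2 hwp
  have hex : ∀ s j, z ∈ columnDomain s j →
      ∃! f, IsJostColumn α u₀ (w s) s (fun x => u x t) z j f := by
    intro s j h
    refine existsUnique_isJostColumn hα hz (isUnit_det_Ymat (hw s) hγ) (hcont t) ?_ h
    cases s with
    | minus => exact hminus t
    | plus => exact (hplus t).mono_set Ioi_subset_Ici_self
  have hwr : ∀ {s s' j j'}, z ∈ columnDomain s j → z ∈ columnDomain s' j' → ∀ x,
      wr (laxJost α u₀ w s u x t z) j (laxJost α u₀ w s' u x t z) j' =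
        wr (laxJost α u₀ w s u 0 t z) j (laxJost α u₀ w s' u 0 t z) j' := fun h h' x =>
    wr_laxJost_eq hα hw hz hγ (hcont t) h h' (hex _ _ h) (hex _ _ h') x 0
  have hc := scatteringMatrix_conj (α := α) (u := u) (t := t) hw
  have hnc := scatteringMatrix_neg_conj (α := α) (u := u) (t := t) hw
  have hinv := scatteringMatrix_inversion (α := α) (u := u) (t := t) hw hu0 hz hγ
  have hc' := fun z => (hc z).trans (neg_sigmaStar_mul_cconj_mul _)
  have hnc' := fun z => (hnc z).trans (sigma1_mul_cconj_mul _)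
  have hinv' := hinv.trans (sigma3_mul_Qmat_inv_mul_mul hwm _ _)
  -- Used at `-z`, the second conjugation refers to `z^*`, as does the first one at `z`. Comparing
  -- the two expresses `S(-z)` as `σ₃ S(z) σ₃`, which is the parity statement.
  have hneg := hnc' (-z)
  simp only [map_neg, neg_neg] at hneg
  refine ⟨hex, fun hz_mem => ?_, fun hD x => ?_, fun hD x => ?_, fun s x => jost_conj (hw s) x z,
    hc z, ?_, fun s x => jost_neg_conj (hw s) x z, hnc z, ?_,
    fun s x => jost_inversion (hw s) hu0 hz hγ x, hinv, ?_, ?_, ?_, ?_, ?_⟩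
  · have hdom : ∀ s j, z ∈ columnDomain s j := by
      have h0 : z.re * z.im = 0 := hz_mem
      intro s j
      cases s <;> fin_cases j <;> simp [columnDomain, closedDPlus, closedDMinus, h0]
    have hM : ∀ x, wr (laxJost α u₀ w .minus u x t z) 0 (laxJost α u₀ w .minus u x t z) 1 =
        gam u₀ z :=
      wr_laxJost_self hα hw hz hγ (hcont t) (hdom _) fun j => hex _ _ (hdom _ _)
    -- Cramer's rule with determinant `γ`, after moving the Wronskians from `0` to `x`.
    have hS : ∀ x, laxJost α u₀ w .plus u x t z =
        laxJost α u₀ w .minus u x t z * scatteringMatrix α u₀ w u t z := by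
      intro x
      have hMx := hM x
      rw [scatteringMatrix]
      simp only [← hwr (hdom _ _) (hdom _ _) x]
      rw [Matrix.mul_smul, eq_inv_smul_iff₀ hγ, ← hMx]
      ext i j
      fin_cases i <;> fin_cases j <;>
        simp [wr, Matrix.mul_apply, Fin.sum_univ_two] <;> ring
    refine ⟨hS, fun S h => ?_⟩
    have hdet : IsUnit (laxJost α u₀ w .minus u 0 t z).det := by
      have hM0 := hM 0
      rw [wr, mul_comm (laxJost α u₀ w .minus u 0 t z 1 0), ← Matrix.det_fin_two] at hM0
      rw [hM0]
      exact hγ.isUnit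
    have e := (h 0).symm.trans (hS 0)
    rw [← Matrix.nonsing_inv_mul_cancel_left _ S hdet, e,
      Matrix.nonsing_inv_mul_cancel_left _ _ hdet]
  · rw [← wr_laxJost_zero_one, hwr (s := .plus) (s' := .minus) (j := 0) (j' := 1) hD hD x]
    simp [scatteringMatrix, div_eq_inv_mul]
  · rw [← wr_laxJost_zero_one, hwr (s := .minus) (s' := .plus) (j := 0) (j' := 1) hD hD x]
    simp [scatteringMatrix, div_eq_inv_mul]
  -- No nonvanishing of `s₁₁` is needed for the three reflection identities: the denominators on the
  -- two sides vanish together, and division by zero gives zero.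
  · rw [rho, rhoTilde, hc' z]
    simp [neg_div]
  · rw [rho, rhoTilde, hnc' z]
    simp
  · rw [rho, rhoTilde, hinv']
    simp
    field_simp
  · rw [hneg, hc' z]
    simp
  · rw [hneg, hc' z]
    simp
  · rw [hneg, hc' z]
    simp
  · rw [hneg, hc' z]
    simp
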